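/- Notation. For positive integers $n,d,n_0$ let $X\in\mathbb R^{n\times n_0}$ have i.i.d. rows that are centred multivariate normal with covariance matrix $\Sigma\in\mathbb R^{n_0\times n_0}$, let $W\in\mathbb R^{n_0\times d}$ have i.i.d. standard normal entries and be independent of $X$, and let $$A=\frac1{\sqrt n}\,\sigma\!\left(\frac{XW}{\sqrt{n_0}}\right)\in\mathbb R^{n\times d},$$ with $\sigma:\mathbb R\to\mathbb R$ applied entrywise. For $z\in\mathbb C\setminus\mathbb R$ put $\mathcal R=(A^{\mathsf T}A-zI_d)^{-1}$ and $\tilde{\mathcal R}=(AA^{\mathsf T}-zI_n)^{-1}$, and write $\overline{\mathrm{tr}}(M)=\frac1m\mathrm{tr}(M)$ for an $m\times m$ matrix $M$. For $c,C,\delta>0$ let $$\mathfrak C_n=\{E+i\eta:\ |E|\le Cn^{\delta},\ cn^{-\delta}\le\eta\le Cn^{\delta}\}.$$ Proposition. There is a universal constant $K>0$ with the following property. Let $\delta,c,C>0$, let $B>0$ and $\kappa\ge 1$, and let $\sigma$ be continuous and, outside an at most countable set, differentiable with $|\sigma'(x)|\le C_0e^{C_1|x|}$ for some constants $C_0,C_1\ge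 0$; assume $\mathbb E\,\sigma(Z)=0$ for a standard normal $Z$. Then there is a constant $C'>0$, and for every $D>0$ a constant $C_D>0$, all depending only on the data fixed so far (and $C_D$ also on $D$), such that for all positive integers $n,d,n_0$ with $\kappa^{-1}n\le d\le\kappa n$ and $\kappa^{-1}n\le n_0\le\kappa n$, all positive semidefinite $\Sigma$ with $\frac1{n_0}\mathrm{tr}(\Sigma)=1$ and operator norm $\|\Sigma\|\le B$, and all $z\in\mathfrak C_n$, with probability at least $1-C_Dn^{-D}$ all of the following hold: $$\max_{1\le\alpha\ne\beta\le d}|\mathcal R_{\alpha\beta}|\le C'n^{K\delta-1/2},\qquad \max_{1\le a\ne b\le n}|\tilde{\mathcal R}_{ab}|\le C'n^{K\delta-1/2},$$ $$\max_{1\le\alpha\le d}|\mathcal R_{\alpha\alpha}-\overline{\mathrm{tr}}(\mathcal R)|\le C'n^{K\delta-1/2},\qquad \max_{1\le a\le n}|\tilde{\mathcal R}_{aa}-\overline{\mathrm{tr}}(\tilde{\mathcal R})|\le C'n^{K\delta-1/2}.$$ -/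

import Mathlib

open MeasureTheory ProbabilityTheory

namespace RandomFeatures

noncomputable section

/-- The entrywise-nonlinear random features matrix `σ(X W / √n₀) / √n`, of size `n × d`. -/
def featureMatrix {n d n₀ : ℕ} (σ : ℝ → ℝ) (X : Matrix (Fin n) (Fin n₀) ℝ)
    (W : Matrix (Fin n₀) (Fin d) ℝ) : Matrix (Fin n) (Fin d) ℝ :=
  Matrix.of fun a α => σ ((X * W) a α / √(n₀ : ℝ)) / √(n : ℝ)

/-- The resolvent `(M - z I)⁻¹` of a real square matrix at a complex argument `z`. -/
def resolvent {m : ℕ} (M : Matrix (Fin m) (Fin m) ℝ) (z : ℂ) : Matrix (Fin m) (Fin m) ℂ :=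
  (M.map (fun x : ℝ => (x : ℂ)) - z • (1 : Matrix (Fin m) (Fin m) ℂ))⁻¹

/-- The normalized trace `(1/m) tr M`. -/
def normTrace {m : ℕ} (M : Matrix (Fin m) (Fin m) ℂ) : ℂ :=
  M.trace / (m : ℂ)

/-- The allowable set of spectral arguments `z = E + i η`:
`|E| ≤ C n^δ` and `c n^{-δ} ≤ η ≤ C n^δ`. -/
def allowable (c C δ : ℝ) (n : ℕ) : Set ℂ :=
  {z | |z.re| ≤ C * (n : ℝ) ^ δ ∧ c * (n : ℝ) ^ (-δ) ≤ z.im ∧ z.im ≤ C * (n : ℝ) ^ δ}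

/-- Activation functions: `σ` is continuous, `|σ'(x)| ≤ C₀ e^{C₁ |x|}` (the derivative may fail to
exist at countably many points, so that piecewise smooth activations such as a shifted ReLU are
included), and `σ` is centred under the standard normal law. -/
structure IsActivation (σ : ℝ → ℝ) (C₀ C₁ : ℝ) : Prop where
  nonneg_C₀ : 0 ≤ C₀
  nonneg_C₁ : 0 ≤ C₁
  continuous : Continuous σ
  deriv_bound : ∃ S : Set ℝ, S.Countable ∧
    ∀ x, x ∉ S → DifferentiableAt ℝ σ x ∧ |deriv σ x| ≤ C₀ * Real.exp (C₁ * |x|)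
  centred : ∫ x, σ x ∂(gaussianReal 0 1) = 0

/-- Data covariance: positive semidefinite, normalized trace one, operator norm at most `B`. -/
structure IsDataCovariance {n₀ : ℕ} (S : Matrix (Fin n₀) (Fin n₀) ℝ) (B : ℝ) : Prop where
  posSemidef : S.PosSemidef
  trace_eq : S.trace / (n₀ : ℝ) = 1
  norm_le : ‖Matrix.toEuclideanCLM (𝕜 := ℝ) S‖ ≤ B

/-- The random features model: the rows of `X` are i.i.d. centred Gaussian vectors with
covariance `S`, the entries of `W` are i.i.d. standard normal, and `X`, `W` are independent. -/
structure IsModel {Ω : Type*} [MeasurableSpace Ω] (μ : Measure Ω) {n d n₀ : ℕ}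
    (S : Matrix (Fin n₀) (Fin n₀) ℝ) (X : Ω → Matrix (Fin n) (Fin n₀) ℝ)
    (W : Ω → Matrix (Fin n₀) (Fin d) ℝ) : Prop where
  row_law : ∀ a, HasLaw (fun ω => WithLp.toLp 2 (X ω a)) (multivariateGaussian 0 S) μ
  row_indep : iIndepFun (fun (a : Fin n) ω => X ω a) μ
  entry_law : ∀ j α, HasLaw (fun ω => W ω j α) (gaussianReal 0 1) μ
  entry_indep : iIndepFun (fun (p : Fin n₀ × Fin d) ω => W ω p.1 p.2) μ
  indep : IndepFun (fun ω a j => X ω a j) (fun ω j α => W ω j α) μ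

/-- `ResolventBounds A z ε`: the off-diagonal entries of `(AᵀA - z)⁻¹` and `(AAᵀ - z)⁻¹` are at
most `ε` in modulus, and the diagonal entries are within `ε` of the normalized trace. -/
structure ResolventBounds {n d : ℕ} (A : Matrix (Fin n) (Fin d) ℝ) (z : ℂ) (ε : ℝ) : Prop where
  offDiag : ∀ α β, α ≠ β → ‖resolvent (A.transpose * A) z α β‖ ≤ ε
  offDiag' : ∀ a b, a ≠ b → ‖resolvent (A * A.transpose) z a b‖ ≤ ε
  diag : ∀ α, ‖resolvent (A.transpose * A) z α α -
    normTrace (resolvent (A.transpose * A) z)‖ ≤ ε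
  diag' : ∀ a, ‖resolvent (A * A.transpose) z a a -
    normTrace (resolvent (A * A.transpose) z)‖ ≤ ε

end

end RandomFeatures

namespace RandomFeatures

open scoped ENNReal NNReal RealInnerProductSpace MatrixOrder

/-! Given `X`, the columns of `A` are i.i.d. feature vectors `(σ ⟪ξ i, w⟫ / √n)ᵢ`, where `ξ i` is a
row of `X` divided by `√n₀` and `w` is a column of `W`. Fix two columns `α ≠ β`, and let `P` be the
resolvent of `A' A'ᵀ`, where `A'` is `A` without these columns. By the Schur complement the 2 × 2
block of `R = (AᵀA - z)⁻¹` at `α, β` has inverse `-z (1 + Q)`, where `Q` (`colForm`) is the form of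
`P` on the two columns. Inverting gives `R_αβ = det · z · Q_αβ` and `R_αα - R_ββ = det · z · (Q_αα -
Q_ββ)`, with `det` the determinant of the block, at most `2 η⁻²` in modulus. Thus no denominator has
to be bounded from below and no limit of the trace identified: diagonal entries are compared with
each other, and averaging gives the trace.

Given `X`, `P` is independent of the two columns. Hence `Q_αα - Q_ββ` is the increment of a
quadratic form between two independent feature vectors, and `Q_αβ` is a bilinear form in them. The
Maurey–Pisier inequality (`lintegral_sub_pow_le`) bounds all moments of increments by moments of the
gradient, which carries the factor `1 / √n`. The bilinear form also needs the mean of a linear form,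
which is small because `σ` is centred and the `ξ i` have norm close to one
(`abs_integral_le_of_centred`).

The data enter through `IsRegular`: a bounded synthesis operator, from a volume argument for
Gaussian matrices (`measure_le_norm_synth_le`), and `‖ξ i‖² ≈ 1`, from the quadratic-form estimate
with `σ = id` and the trace normalization. Markov's inequality with a high moment and a union bound
over pairs of columns give any power of `n`. The second resolvent comes from a symmetry: the root of
`Σ` is self-adjoint, so `Aᵀ` is the same model with the roles of the two Gaussian families exchanged
(`transpose_featMat`). -/

/-- Jensen's inequality for powers of a lower integral. -/
theorem pow_lintegral_le {α : Type*} [MeasurableSpace α] (μ : Measure α) {f : α → ℝ≥0∞}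
    (hf : AEMeasurable f μ) (p : ℕ) :
    (∫⁻ x, f x ∂μ) ^ (p + 1) ≤ μ Set.univ ^ p * ∫⁻ x, f x ^ (p + 1) ∂μ := by
  rcases Nat.eq_zero_or_pos p with rfl | hp
  · simp
  have hpq : Real.HolderConjugate ((p : ℝ) + 1) (((p : ℝ) + 1) / p) := by
    have hp' : (0 : ℝ) < p := by exact_mod_cast hp
    rw [Real.holderConjugate_iff]
    refine ⟨by linarith, by field_simp; ring⟩
  have h := ENNReal.lintegral_mul_le_Lp_mul_Lq μ hpq hf
    (aemeasurable_const (b := (1 : ℝ≥0∞)))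
  simp only [Pi.mul_apply, mul_one, ENNReal.one_rpow, lintegral_const, one_mul] at h
  have hp' : (0 : ℝ) < p := by exact_mod_cast hp
  calc (∫⁻ x, f x ∂μ) ^ (p + 1) ≤ _ := pow_le_pow_left' h (p + 1)
    _ = μ Set.univ ^ p * ∫⁻ x, f x ^ (p + 1) ∂μ := by
      rw [mul_pow, ← ENNReal.rpow_natCast, ← ENNReal.rpow_natCast, ← ENNReal.rpow_mul,
        ← ENNReal.rpow_mul, mul_comm]
      congr 1
      · rw [← ENNReal.rpow_natCast]; congr 1; push_cast; field_simp
      · push_cast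
        rw [one_div_mul_cancel (by positivity), ENNReal.rpow_one]
        simp_rw [← ENNReal.rpow_natCast]
        push_cast; rfl

/-! ### Moments of increments of functions on Gaussian space -/

section MaureyPisier
variable {E : Type*} [NormedAddCommGroup E] [InnerProductSpace ℝ E] [FiniteDimensional ℝ E]
  [MeasurableSpace E] [BorelSpace E]

theorem map_inner_stdGaussian (x : E) :
    (stdGaussian E).map (fun w => ⟪x, w⟫) = gaussianReal 0 (‖x‖₊ ^ 2) := by
  have h := IsGaussian.map_eq_gaussianReal (μ := stdGaussian E) (innerSL ℝ x)
  have h2 : (fun w => ⟪x, w⟫) = (innerSL ℝ x : E → ℝ) := by ext; simp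
  rw [h2, h, variance_dual_stdGaussian, integral_strongDual_stdGaussian]
  congr 1
  ext; simp

/-- The absolute moment of order `p` of a standard normal variable. -/
noncomputable def gaussianMoment (p : ℕ) : ℝ≥0∞ := ∫⁻ t, ‖t‖ₑ ^ p ∂(gaussianReal 0 1)

theorem gaussianMoment_lt_top (p : ℕ) : gaussianMoment p < ⊤ := by
  rcases Nat.eq_zero_or_pos p with rfl | hp
  · simp [gaussianMoment]
  have h := memLp_id_gaussianReal (μ := 0) (v := 1) (p : ℝ≥0)
  have h2 := lintegral_rpow_enorm_lt_top_of_eLpNorm_lt_top (by simp; omega) (by simp) h.2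
  simpa [gaussianMoment] using h2

theorem lintegral_inner_pow (x : E) (p : ℕ) :
    ∫⁻ w, ‖⟪x, w⟫‖ₑ ^ p ∂(stdGaussian E) = gaussianMoment p * ‖x‖ₑ ^ p := by
  have h1 : ∫⁻ w, ‖⟪x, w⟫‖ₑ ^ p ∂(stdGaussian E)
      = ∫⁻ t, ‖t‖ₑ ^ p ∂(gaussianReal 0 (‖x‖₊ ^ 2)) := by
    rw [← map_inner_stdGaussian, lintegral_map (by fun_prop) (by fun_prop)]
  have h2 : gaussianReal 0 (‖x‖₊ ^ 2) = (gaussianReal 0 1).map (fun t => ‖x‖ * t) := by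
    rw [gaussianReal_map_const_mul]
    congr 1
    · simp
    · ext; simp
  rw [h1, h2, lintegral_map (by fun_prop) (by fun_prop), gaussianMoment, mul_comm,
    ← lintegral_const_mul _ (by fun_prop)]
  refine lintegral_congr fun t => ?_
  rw [enorm_mul, mul_pow, enorm_norm]

/-- **Maurey–Pisier inequality** for the increments of a function on Gaussian space. -/
theorem lintegral_sub_pow_le {f : E → ℝ} {g : E → E} (hg : Measurable g) (p : ℕ)
    (hpath : ∀ u v, ‖f v - f u‖ₑ ≤ ∫⁻ θ in Set.Icc 0 (Real.pi / 2),
      ‖⟪g (Real.cos θ • u + Real.sin θ • v), -Real.sin θ • u + Real.cos θ • v⟫‖ₑ) :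
    ∫⁻ u, ∫⁻ v, ‖f v - f u‖ₑ ^ (p + 1) ∂(stdGaussian E) ∂(stdGaussian E) ≤
      ENNReal.ofReal (Real.pi / 2) ^ (p + 1) * gaussianMoment (p + 1) *
        ∫⁻ u, ‖g u‖ₑ ^ (p + 1) ∂(stdGaussian E) := by
  set γ := stdGaussian E
  set ν := (volume : Measure ℝ).restrict (Set.Icc 0 (Real.pi / 2)) with hν
  have hνu : ν Set.univ = ENNReal.ofReal (Real.pi / 2) := by simp [hν]
  let φ : ℝ → E × E → ℝ≥0∞ := fun θ q =>
      ‖⟪g (Real.cos θ • q.1 + Real.sin θ • q.2), -Real.sin θ • q.1 + Real.cos θ • q.2⟫‖ₑ ^ (p + 1)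
  have hφ : Measurable (fun r : ℝ × (E × E) => φ r.1 r.2) := by
    simp only [φ]
    refine Measurable.pow_const (Measurable.enorm ?_) _
    refine Measurable.inner (hg.comp ?_) ?_ <;> fun_prop
  -- The pair (point, velocity) on the path is a rotation of `(u, v)`, so it is again a pair of
  -- independent standard Gaussians, for every `θ`.
  have hrot : ∀ θ, ∫⁻ q, φ θ q ∂(γ.prod γ) =
      ∫⁻ q : E × E, ‖⟪g q.1, q.2⟫‖ₑ ^ (p + 1) ∂(γ.prod γ) := by
    intro θ
    have h := IsGaussian.map_rotation_eq_self (μ := γ) (by simp [γ]) θ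
    conv_rhs => rw [← h]
    rw [lintegral_map (by fun_prop) (by fun_prop)]
    rfl
  have hstep : ∀ u v, ‖f v - f u‖ₑ ^ (p + 1) ≤
      ENNReal.ofReal (Real.pi / 2) ^ p * ∫⁻ θ, φ θ (u, v) ∂ν := by
    intro u v
    refine (pow_le_pow_left' (hpath u v) _).trans ?_
    rw [← hνu]
    refine pow_lintegral_le ν ?_ p
    refine Measurable.aemeasurable (Measurable.enorm ?_)
    refine Measurable.inner (hg.comp ?_) ?_ <;> fun_prop
  have hint : ∫⁻ q : E × E, ‖⟪g q.1, q.2⟫‖ₑ ^ (p + 1) ∂(γ.prod γ) =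
      -- For fixed `u` the pairing with the independent velocity is a centred normal variable of
      -- standard deviation `‖g u‖`.
      gaussianMoment (p + 1) * ∫⁻ u, ‖g u‖ₑ ^ (p + 1) ∂γ := by
    rw [lintegral_prod _ (by fun_prop), ← lintegral_const_mul _ (by fun_prop)]
    exact lintegral_congr fun u => lintegral_inner_pow (g u) (p + 1)
  have hmeas : Measurable (fun q : E × E => ∫⁻ θ, φ θ q ∂ν) :=
    Measurable.lintegral_prod_left hφ
  calc ∫⁻ u, ∫⁻ v, ‖f v - f u‖ₑ ^ (p + 1) ∂γ ∂γ
      ≤ ∫⁻ u, ∫⁻ v, ENNReal.ofReal (Real.pi / 2) ^ p * ∫⁻ θ, φ θ (u, v) ∂ν ∂γ ∂γ :=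
        lintegral_mono fun u => lintegral_mono fun v => hstep u v
    _ = ∫⁻ q, ENNReal.ofReal (Real.pi / 2) ^ p * ∫⁻ θ, φ θ q ∂ν ∂(γ.prod γ) := by
        rw [lintegral_prod _ (hmeas.const_mul _).aemeasurable]
    _ = ENNReal.ofReal (Real.pi / 2) ^ p * ∫⁻ θ, ∫⁻ q, φ θ q ∂(γ.prod γ) ∂ν := by
        rw [lintegral_const_mul _ hmeas, lintegral_lintegral_swap]
        exact (hφ.comp measurable_swap).aemeasurable
    _ = _ := by
        simp_rw [hrot, hint]
        rw [lintegral_const, hνu]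
        ring

/-- Moments about the mean are bounded by moments of increments. -/
theorem lintegral_sub_integral_pow_le {α : Type*} [MeasurableSpace α] (γ : Measure α)
    [IsProbabilityMeasure γ] {f : α → ℝ} (hf : Integrable f γ) (p : ℕ) :
    ∫⁻ u, ‖f u - ∫ v, f v ∂γ‖ₑ ^ (p + 1) ∂γ ≤ ∫⁻ u, ∫⁻ v, ‖f v - f u‖ₑ ^ (p + 1) ∂γ ∂γ := by
  refine lintegral_mono fun u => ?_
  -- The mean is replaced by an independent copy and Jensen is applied to the average over that
  -- copy.
  have h1 : f u - ∫ v, f v ∂γ = ∫ v, (f u - f v) ∂γ := by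
    rw [integral_sub (integrable_const _) hf]; simp
  have h2 : ‖f u - ∫ v, f v ∂γ‖ₑ ≤ ∫⁻ v, ‖f v - f u‖ₑ ∂γ := by
    rw [h1]
    refine (enorm_integral_le_lintegral_enorm _).trans (le_of_eq ?_)
    exact lintegral_congr fun v => enorm_sub_rev _ _
  refine (pow_le_pow_left' h2 _).trans ?_
  refine (pow_lintegral_le γ ?_ p).trans ?_
  · exact (hf.1.aemeasurable.sub_const _).enorm
  · simp
end MaureyPisier

/-! ### Differentiation of nonsmooth features along a rotation path -/

theorem countable_trig_level {A B : ℝ} (hAB : ¬ (A = 0 ∧ B = 0)) (s : ℝ) :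
    {θ ∈ Set.Ioo 0 (Real.pi / 2) | Real.cos θ * A + Real.sin θ * B = s}.Countable := by
  have hpos : 0 < A ^ 2 + B ^ 2 := by
    by_contra h
    exact hAB ⟨by nlinarith [sq_nonneg A, sq_nonneg B], by nlinarith [sq_nonneg A, sq_nonneg B]⟩
  let q : Polynomial ℝ := Polynomial.C (A ^ 2 + B ^ 2) * Polynomial.X ^ 2 +
    Polynomial.C (-2 * s * B) * Polynomial.X + Polynomial.C (s ^ 2 - A ^ 2)
  have hq : q ≠ 0 := by
    intro h
    have he : ∀ x, (A ^ 2 + B ^ 2) * x ^ 2 + -2 * s * B * x + (s ^ 2 - A ^ 2) = 0 := by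
      intro x
      simpa only [q, Polynomial.eval_add, Polynomial.eval_mul, Polynomial.eval_C,
        Polynomial.eval_pow, Polynomial.eval_X, Polynomial.eval_zero] using
        congrArg (Polynomial.eval x) h
    -- The second difference of the values at `-1, 0, 1` is `2 (A² + B²)`.
    linarith [he 0, he 1, he (-1)]
  -- Eliminating `cos θ` from the equation leaves a nonzero quadratic for `sin θ`, and `sin` is
  -- injective on the interval.
  have hfin : {x : ℝ | q.IsRoot x}.Finite := Polynomial.finite_setOfPred_isRoot hq
  refine Set.MapsTo.countable_of_injOn (f := Real.sin) (t := {x : ℝ | q.IsRoot x}) ?_ ?_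
    hfin.countable
  · rintro θ ⟨-, h⟩
    simp only [Set.mem_ofPred_eq, Polynomial.IsRoot.def, q]
    simp only [Polynomial.eval_add, Polynomial.eval_mul, Polynomial.eval_C, Polynomial.eval_pow,
      Polynomial.eval_X]
    have hc := Real.sin_sq_add_cos_sq θ
    have : (s - Real.sin θ * B) ^ 2 = (Real.cos θ * A) ^ 2 := by rw [← h]; ring
    linear_combination this + A ^ 2 * hc
  · refine Real.injOn_sin.mono ?_
    rintro θ ⟨h, -⟩
    exact ⟨by linarith [h.1, Real.pi_pos], h.2.le⟩

section Feature
variable {E : Type*} [NormedAddCommGroup E] [InnerProductSpace ℝ E]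
variable {ι : Type*}

/-- The feature vector `(σ ⟪ξ i, w⟫ / s)ᵢ`. -/
noncomputable def feat (σ : ℝ → ℝ) (ξ : ι → E) (s : ℝ) (w : E) : ι → ℝ := fun i => σ ⟪ξ i, w⟫ / s

theorem continuous_feat {σ : ℝ → ℝ} (hσ : Continuous σ) (ξ : ι → E) (s : ℝ) :
    Continuous (feat σ ξ s) :=
  continuous_pi fun i => by unfold feat; fun_prop

variable [Fintype ι]

/-- `ψ` is a derivative of `σ` off a countable set, and both grow at most exponentially. -/
structure ExpDeriv (σ ψ : ℝ → ℝ) (b : ℝ) : Prop where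
  continuous : Continuous σ
  measurable : Measurable ψ
  pos : 0 < b
  bound : ∀ t, |σ t| ≤ b * Real.exp (b * |t|)
  deriv_bound : ∀ t, |ψ t| ≤ b * Real.exp (b * |t|)
  hasDerivAt : ∃ S : Set ℝ, S.Countable ∧ ∀ t, t ∉ S → HasDerivAt σ (ψ t) t

/-- The gradient of `Φ ∘ feat σ ξ s` in terms of the gradient `Γ` of `Φ`. -/
noncomputable def featGrad (σ ψ : ℝ → ℝ) (ξ : ι → E) (s : ℝ) (Γ : (ι → ℝ) → ι → ℝ) (w : E) : E :=
  ∑ i, (Γ (feat σ ξ s w) i * ψ ⟪ξ i, w⟫ / s) • ξ i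

theorem measurable_featGrad [FiniteDimensional ℝ E] [MeasurableSpace E] [BorelSpace E]
    {σ ψ : ℝ → ℝ} {b : ℝ} (h : ExpDeriv σ ψ b) (ξ : ι → E) (s : ℝ)
    {Γ : (ι → ℝ) → ι → ℝ} (hΓ : Continuous Γ) : Measurable (featGrad σ ψ ξ s Γ) := by
  have h1 : ∀ i, Measurable fun w => Γ (feat σ ξ s w) i := fun i =>
    ((continuous_apply i).comp (hΓ.comp (continuous_feat h.continuous ξ s))).measurable
  have h2 : ∀ i, Measurable fun w : E => ψ ⟪ξ i, w⟫ := fun i => h.measurable.comp (by fun_prop)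
  exact Finset.measurable_sum _ fun i _ => (((h1 i).mul (h2 i)).div_const s).smul_const _

/-- This supplies the path hypothesis of `lintegral_sub_pow_le`. The path meets the exceptional
points of `σ` at only countably many `θ`, and the fundamental theorem of calculus tolerates a
countable exceptional set. -/
theorem enorm_comp_feat_sub_le {σ ψ : ℝ → ℝ} {b : ℝ} [FiniteDimensional ℝ E] [MeasurableSpace E]
    [BorelSpace E] (h : ExpDeriv σ ψ b) (ξ : ι → E) (s : ℝ)
    {Φ : (ι → ℝ) → ℝ} {Γ : (ι → ℝ) → ι → ℝ} (hΓ : Continuous Γ)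
    (hΦ : ∀ a, HasFDerivAt Φ (∑ i, Γ a i • (ContinuousLinearMap.proj i : (ι → ℝ) →L[ℝ] ℝ)) a)
    (u v : E) :
    ‖Φ (feat σ ξ s v) - Φ (feat σ ξ s u)‖ₑ ≤ ∫⁻ θ in Set.Icc 0 (Real.pi / 2),
      ‖⟪featGrad σ ψ ξ s Γ (Real.cos θ • u + Real.sin θ • v),
        -Real.sin θ • u + Real.cos θ • v⟫‖ₑ := by
  set W : ℝ → E := fun θ => Real.cos θ • u + Real.sin θ • v with hW
  set F : ℝ → ℝ := fun θ => Φ (feat σ ξ s (W θ)) with hF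
  set F' : ℝ → ℝ := fun θ => ⟪featGrad σ ψ ξ s Γ (W θ), -Real.sin θ • u + Real.cos θ • v⟫ with hF'
  have hF'm : Measurable F' :=
    Measurable.inner ((measurable_featGrad h ξ s hΓ).comp (by fun_prop)) (by fun_prop)
  -- If the right side is infinite nothing is to be shown; otherwise the derivative is integrable,
  -- as the fundamental theorem requires.
  by_cases htop : ∫⁻ θ in Set.Icc 0 (Real.pi / 2), ‖F' θ‖ₑ = ⊤
  · change _ ≤ ∫⁻ θ in Set.Icc 0 (Real.pi / 2), ‖F' θ‖ₑ
    rw [htop]; exact le_top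
  have hint : IntegrableOn F' (Set.Icc 0 (Real.pi / 2)) :=
    ⟨hF'm.aestronglyMeasurable, lt_top_iff_ne_top.2 htop⟩
  have hpi : (0 : ℝ) ≤ Real.pi / 2 := by positivity
  have hΦc : Continuous Φ := continuous_iff_continuousAt.2 fun a => (hΦ a).continuousAt
  obtain ⟨S, hS, hd⟩ := h.hasDerivAt
  set T : Set ℝ := ⋃ i : ι, ⋃ t ∈ S, {θ ∈ Set.Ioo 0 (Real.pi / 2) |
    Real.cos θ * ⟪ξ i, u⟫ + Real.sin θ * ⟪ξ i, v⟫ = t ∧ ¬ (⟪ξ i, u⟫ = 0 ∧ ⟪ξ i, v⟫ = 0)} with hT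
  have hTc : T.Countable := by
    refine Set.countable_iUnion fun i => hS.biUnion fun t _ => ?_
    by_cases hi : ⟪ξ i, u⟫ = 0 ∧ ⟪ξ i, v⟫ = 0
    · simp [hi]
    · simpa only [hi, not_false_iff, and_true] using countable_trig_level hi t
  have hWi : ∀ i θ, ⟪ξ i, W θ⟫ = Real.cos θ * ⟪ξ i, u⟫ + Real.sin θ * ⟪ξ i, v⟫ := by
    intro i θ; simp [hW, inner_add_right, inner_smul_right]
  have hderiv : ∀ θ ∈ Set.Ioo (min 0 (Real.pi / 2)) (max 0 (Real.pi / 2)) \ T,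
      HasDerivAt F (F' θ) θ := by
    rintro θ ⟨hθ, hθT⟩
    rw [min_eq_left hpi, max_eq_right hpi] at hθ
    have hcoord : ∀ i, HasDerivAt (fun θ => feat σ ξ s (W θ) i)
        (ψ ⟪ξ i, W θ⟫ * ⟪ξ i, -Real.sin θ • u + Real.cos θ • v⟫ / s) θ := by
      intro i
      have hin : HasDerivAt (fun θ => Real.cos θ * ⟪ξ i, u⟫ + Real.sin θ * ⟪ξ i, v⟫)
          (⟪ξ i, -Real.sin θ • u + Real.cos θ • v⟫) θ := by
        have := ((Real.hasDerivAt_cos θ).mul_const ⟪ξ i, u⟫).fun_add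
          ((Real.hasDerivAt_sin θ).mul_const ⟪ξ i, v⟫)
        refine this.congr_deriv ?_
        simp [inner_add_right, inner_smul_right]
      have hfe : (fun θ => feat σ ξ s (W θ) i) =
          fun θ => σ (Real.cos θ * ⟪ξ i, u⟫ + Real.sin θ * ⟪ξ i, v⟫) / s := by
        ext θ; rw [feat, hWi]
      rw [hfe, hWi]
      refine HasDerivAt.div_const ?_ s
      -- In this degenerate case the argument of `σ` stays at `0`, possibly an exceptional point,
      -- but the coordinate is constant.
      by_cases hi : ⟪ξ i, u⟫ = 0 ∧ ⟪ξ i, v⟫ = 0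
      · have h0 : ⟪ξ i, -Real.sin θ • u + Real.cos θ • v⟫ = 0 := by
          simp [inner_add_right, inner_smul_right, hi.1, hi.2]
        simp only [hi.1, hi.2, h0, mul_zero, add_zero]
        exact hasDerivAt_const _ _
      · refine HasDerivAt.comp θ (hd _ ?_) hin
        intro hmem
        refine hθT (Set.mem_iUnion.2 ⟨i, Set.mem_iUnion₂.2 ⟨_, hmem, hθ, rfl, hi⟩⟩)
    have hvec : HasDerivAt (fun θ => feat σ ξ s (W θ))
        (fun i => ψ ⟪ξ i, W θ⟫ * ⟪ξ i, -Real.sin θ • u + Real.cos θ • v⟫ / s) θ :=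
      hasDerivAt_pi.2 hcoord
    have := (hΦ (feat σ ξ s (W θ))).comp_hasDerivAt θ hvec
    refine this.congr_deriv ?_
    simp only [hF', featGrad, sum_inner, real_inner_smul_left, sum_apply,
      smul_apply, ContinuousLinearMap.proj_apply, smul_eq_mul]
    exact Finset.sum_congr rfl fun i _ => by ring
  have hFc : Continuous F := hΦc.comp ((continuous_feat h.continuous ξ s).comp (by fun_prop))
  have key := integral_eq_of_hasDerivAt_off_countable F F' hTc hFc.continuousOn hderiv
    ((intervalIntegrable_iff_integrableOn_Icc_of_le hpi).2 hint)
  have h1 : Φ (feat σ ξ s v) - Φ (feat σ ξ s u) = ∫ θ in Set.Icc 0 (Real.pi / 2), F' θ := by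
    rw [integral_Icc_eq_integral_Ioc, ← intervalIntegral.integral_of_le hpi, key]
    simp [hF, hW]
  rw [h1]
  exact enorm_integral_le_lintegral_enorm _
end Feature

/-! ### Moments of increments of linear and quadratic forms in the features -/

section Envelope
variable {ι : Type*} [Fintype ι]

/-- The Euclidean norm of a finite family of reals. -/
noncomputable def l2 (q : ι → ℝ) : ℝ := √(∑ i, q i ^ 2)

theorem l2_nonneg (q : ι → ℝ) : 0 ≤ l2 q := Real.sqrt_nonneg _

theorem sq_l2 (q : ι → ℝ) : l2 q ^ 2 = ∑ i, q i ^ 2 :=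
  Real.sq_sqrt (Finset.sum_nonneg fun _ _ => sq_nonneg _)

theorem l2_le_sqrt_card_mul {q : ι → ℝ} {r : ℝ} (hr : 0 ≤ r) (h : ∀ i, |q i| ≤ r) :
    l2 q ≤ √(Fintype.card ι) * r := by
  refine Real.sqrt_le_iff.2 ⟨by positivity, ?_⟩
  rw [mul_pow, Real.sq_sqrt (by positivity)]
  calc ∑ i, q i ^ 2 ≤ ∑ _i : ι, r ^ 2 := Finset.sum_le_sum fun i _ =>
        sq_le_sq' (by linarith [abs_le.1 (h i)]) (abs_le.1 (h i)).2
    _ = Fintype.card ι * r ^ 2 := by simp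

theorem l2_mul_le {q c : ι → ℝ} {r : ℝ} (hr : 0 ≤ r) (h : ∀ i, |c i| ≤ r) :
    l2 (fun i => q i * c i) ≤ r * l2 q := by
  refine Real.sqrt_le_iff.2 ⟨mul_nonneg hr (l2_nonneg _), ?_⟩
  rw [mul_pow, sq_l2, Finset.mul_sum]
  refine Finset.sum_le_sum fun i _ => ?_
  rw [mul_pow, mul_comm]
  exact mul_le_mul_of_nonneg_right (sq_le_sq' (by linarith [abs_le.1 (h i)]) (abs_le.1 (h i)).2)
    (sq_nonneg _)

theorem l2_smul (c : ℝ) (q : ι → ℝ) : l2 (fun i => c * q i) = |c| * l2 q := by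
  rw [l2, l2]
  simp_rw [mul_pow, ← Finset.mul_sum]
  rw [Real.sqrt_mul (sq_nonneg _), Real.sqrt_sq_eq_abs]

theorem abs_sum_mul_le_l2 (q c : ι → ℝ) : |∑ i, q i * c i| ≤ l2 q * l2 c := by
  refine abs_le_of_sq_le_sq ?_ (mul_nonneg (l2_nonneg _) (l2_nonneg _))
  rw [mul_pow, sq_l2, sq_l2]
  exact Finset.sum_mul_sq_le_sq_mul_sq _ _ _

variable {E : Type*} [NormedAddCommGroup E] [InnerProductSpace ℝ E]

/-- The synthesis operator of the family `ξ` has norm at most `L`. -/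
def SynthesisBound (ξ : ι → E) (L : ℝ) : Prop := ∀ c : ι → ℝ, ‖∑ i, c i • ξ i‖ ≤ L * l2 c

theorem SynthesisBound.norm_le {ξ : ι → E} {L : ℝ} (h : SynthesisBound ξ L) (i : ι) :
    ‖ξ i‖ ≤ L := by
  classical
  have := h (Pi.single i 1)
  simpa [l2, Pi.single_apply, ite_pow] using this

/-- An additive upper bound for the exponential of the largest linear feature. -/
noncomputable def envelope (ξ : ι → E) (k : ℝ) (w : E) : ℝ := ∑ i, Real.exp (k * |⟪ξ i, w⟫|)

/-- Replaces the exponential of a maximum by a sum over `ι`, whose mean is explicit. The price is a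
factor `Fintype.card ι`, which a high moment absorbs. -/
theorem exists_envelope [Nonempty ι] (ξ : ι → E) (w : E) : ∃ Y : ℝ, (∀ i, |⟪ξ i, w⟫| ≤ Y) ∧
    ∀ k, Real.exp (k * Y) ≤ envelope ξ k w := by
  obtain ⟨i, hi⟩ := Finite.exists_max fun i => |⟪ξ i, w⟫|
  refine ⟨_, hi, fun k => ?_⟩
  exact Finset.single_le_sum (f := fun i => Real.exp (k * |⟪ξ i, w⟫|))
    (fun _ _ => (Real.exp_pos _).le) (Finset.mem_univ i)

theorem lintegral_exp_abs_gaussianReal_le (v : ℝ≥0) (k : ℝ) :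
    ∫⁻ t, ENNReal.ofReal (Real.exp (k * |t|)) ∂(gaussianReal 0 v) ≤
      ENNReal.ofReal (2 * Real.exp (v * k ^ 2 / 2)) := by
  have hi : ∀ r : ℝ, Integrable (fun t => Real.exp (r * t)) (gaussianReal 0 v) := fun r =>
    integrable_exp_mul_gaussianReal r
  have hm : ∀ r : ℝ, ∫ t, Real.exp (r * t) ∂(gaussianReal 0 v) = Real.exp (v * r ^ 2 / 2) := by
    intro r
    have := congrFun (mgf_id_gaussianReal (μ := 0) (v := v)) r
    simpa [mgf] using this
  calc ∫⁻ t, ENNReal.ofReal (Real.exp (k * |t|)) ∂(gaussianReal 0 v)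
      ≤ ∫⁻ t, ENNReal.ofReal (Real.exp (k * t) + Real.exp (-k * t)) ∂(gaussianReal 0 v) := by
        refine lintegral_mono fun t => ENNReal.ofReal_le_ofReal ?_
        rcases abs_cases t with ⟨h, -⟩ | ⟨h, -⟩ <;> rw [h]
        · linarith [Real.exp_pos (-k * t)]
        · rw [show k * -t = -k * t by ring]; linarith [Real.exp_pos (k * t)]
    _ = ENNReal.ofReal (∫ t, (Real.exp (k * t) + Real.exp (-k * t)) ∂(gaussianReal 0 v)) := by
        refine (ofReal_integral_eq_lintegral_ofReal ((hi k).add (hi (-k))) ?_).symm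
        exact .of_forall fun t => (add_pos (Real.exp_pos _) (Real.exp_pos _)).le
    _ = _ := by
        rw [integral_add (hi _) (hi _), hm, hm]; congr 1; ring_nf

theorem norm_featGrad_le {σ ψ : ℝ → ℝ} {b L s Y : ℝ} (h : ExpDeriv σ ψ b) (hs : 0 < s)
    {ξ : ι → E} (hξ : SynthesisBound ξ L) (hL : 0 ≤ L) (Γ : (ι → ℝ) → ι → ℝ) {w : E}
    (hY : ∀ i, |⟪ξ i, w⟫| ≤ Y) :
    ‖featGrad σ ψ ξ s Γ w‖ ≤ L * (b * Real.exp (b * Y) / s * l2 (Γ (feat σ ξ s w))) := by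
  refine (hξ _).trans (mul_le_mul_of_nonneg_left ?_ hL)
  simp_rw [mul_div_assoc]
  have hb := h.pos
  refine l2_mul_le (by positivity) fun i => ?_
  rw [abs_div, abs_of_pos hs, ← mul_div_assoc]
  refine div_le_div_of_nonneg_right ((h.deriv_bound _).trans ?_) hs.le
  gcongr
  exact hY i

theorem l2_feat_le {σ ψ : ℝ → ℝ} {b s κ Y : ℝ} (h : ExpDeriv σ ψ b) (hs : 0 < s)
    (hκ : (Fintype.card ι : ℝ) ≤ κ * s ^ 2) {ξ : ι → E} {w : E} (hY : ∀ i, |⟪ξ i, w⟫| ≤ Y) :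
    l2 (feat σ ξ s w) ≤ √κ * (b * Real.exp (b * Y)) := by
  have hb := h.pos
  refine (l2_le_sqrt_card_mul (r := b * Real.exp (b * Y) / s) (by positivity) fun i => ?_).trans ?_
  · rw [feat, abs_div, abs_of_pos hs]
    gcongr
    refine (h.bound _).trans ?_
    gcongr
    exact hY i
  · have h1 : √(Fintype.card ι : ℝ) ≤ √κ * s := by
      rw [← Real.sqrt_sq hs.le, ← Real.sqrt_mul' _ (sq_nonneg s)]
      exact Real.sqrt_le_sqrt hκ
    calc _ ≤ √κ * s * (b * Real.exp (b * Y) / s) := by gcongr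
      _ = _ := by field_simp

variable [FiniteDimensional ℝ E] [MeasurableSpace E] [BorelSpace E]

theorem lintegral_envelope_le {ξ : ι → E} {L : ℝ} (h : SynthesisBound ξ L) (k : ℝ) :
    ∫⁻ w, ENNReal.ofReal (envelope ξ k w) ∂(stdGaussian E) ≤
      Fintype.card ι * ENNReal.ofReal (2 * Real.exp (L ^ 2 * k ^ 2 / 2)) := by
  have h1 : ∀ w, ENNReal.ofReal (envelope ξ k w) =
      ∑ i, ENNReal.ofReal (Real.exp (k * |⟪ξ i, w⟫|)) := fun w =>
    ENNReal.ofReal_sum_of_nonneg fun _ _ => (Real.exp_pos _).le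
  simp_rw [h1]
  rw [lintegral_finsetSum _ (fun i _ => by fun_prop)]
  calc _ ≤ ∑ _i : ι, ENNReal.ofReal (2 * Real.exp (L ^ 2 * k ^ 2 / 2)) := by
        refine Finset.sum_le_sum fun i _ => ?_
        have h2 : ∫⁻ w, ENNReal.ofReal (Real.exp (k * |⟪ξ i, w⟫|)) ∂(stdGaussian E) =
            ∫⁻ t, ENNReal.ofReal (Real.exp (k * |t|)) ∂(gaussianReal 0 (‖ξ i‖₊ ^ 2)) := by
          rw [← map_inner_stdGaussian, lintegral_map (by fun_prop) (by fun_prop)]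
        rw [h2]
        refine (lintegral_exp_abs_gaussianReal_le _ _).trans (ENNReal.ofReal_le_ofReal ?_)
        have := h.norm_le i
        push_cast
        gcongr
    _ = _ := by simp

/-- Constant in the moment bound for increments of functions of the features. -/
noncomputable def incrConst (p : ℕ) (L k : ℝ) : ℝ≥0∞ :=
  ENNReal.ofReal (Real.pi / 2) ^ p * gaussianMoment p *
    ENNReal.ofReal (2 * Real.exp (L ^ 2 * (k * p) ^ 2 / 2))

theorem incrConst_lt_top (p : ℕ) (L k : ℝ) : incrConst p L k < ⊤ :=
  ENNReal.mul_lt_top (ENNReal.mul_lt_top (by simp) (gaussianMoment_lt_top p))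
    ENNReal.ofReal_lt_top

/-- Maurey–Pisier with a gradient bounded by `r` times an exponential of the largest feature. After
taking the power, the exponential is still integrated by the envelope, with `k` multiplied by the
order of the moment. -/
theorem lintegral_comp_feat_sub_pow_le [Nonempty ι] {σ ψ : ℝ → ℝ} {b L s k r : ℝ}
    (h : ExpDeriv σ ψ b) {ξ : ι → E} (hξ : SynthesisBound ξ L)
    {Φ : (ι → ℝ) → ℝ} {Γ : (ι → ℝ) → ι → ℝ} (hΓ : Continuous Γ) (hr : 0 ≤ r)
    (hΦ : ∀ a, HasFDerivAt Φ (∑ i, Γ a i • (ContinuousLinearMap.proj i : (ι → ℝ) →L[ℝ] ℝ)) a)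
    (hg : ∀ w Y, (∀ i, |⟪ξ i, w⟫| ≤ Y) → ‖featGrad σ ψ ξ s Γ w‖ ≤ r * Real.exp (k * Y)) (p : ℕ) :
    ∫⁻ u, ∫⁻ v, ‖Φ (feat σ ξ s v) - Φ (feat σ ξ s u)‖ₑ ^ (p + 1)
      ∂(stdGaussian E) ∂(stdGaussian E) ≤
      incrConst (p + 1) L k * Fintype.card ι * ENNReal.ofReal (r ^ (p + 1)) := by
  refine (lintegral_sub_pow_le (f := fun w => Φ (feat σ ξ s w)) (measurable_featGrad h ξ s hΓ) p
    (enorm_comp_feat_sub_le h ξ s hΓ hΦ)).trans ?_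
  have h1 : ∫⁻ w, ‖featGrad σ ψ ξ s Γ w‖ₑ ^ (p + 1) ∂(stdGaussian E) ≤
      ENNReal.ofReal (r ^ (p + 1)) *
        (Fintype.card ι * ENNReal.ofReal (2 * Real.exp (L ^ 2 * (k * (p + 1 : ℕ)) ^ 2 / 2))) := by
    refine le_trans ?_ (mul_le_mul_right (lintegral_envelope_le hξ (k * (p + 1 : ℕ))) _)
    rw [← lintegral_const_mul' _ _ ENNReal.ofReal_ne_top]
    refine lintegral_mono fun w => ?_
    obtain ⟨Y, hY, hYe⟩ := exists_envelope ξ w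
    rw [← ofReal_norm, ← ENNReal.ofReal_pow (norm_nonneg _),
      ← ENNReal.ofReal_mul (pow_nonneg hr _)]
    refine ENNReal.ofReal_le_ofReal ?_
    refine (pow_le_pow_left₀ (norm_nonneg _) (hg w Y hY) _).trans ?_
    rw [mul_pow]
    refine mul_le_mul_of_nonneg_left ?_ (pow_nonneg hr _)
    rw [← Real.exp_nat_mul]
    refine le_trans (le_of_eq ?_) (hYe (k * (p + 1 : ℕ)))
    ring_nf
  calc _ ≤ _ := mul_le_mul_right h1 _
    _ = _ := by rw [incrConst]; ring

/-- Increments of linear forms in the features. -/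
theorem lintegral_linear_sub_pow_le [Nonempty ι] {σ ψ : ℝ → ℝ} {b L s : ℝ}
    (h : ExpDeriv σ ψ b) (hs : 0 < s) {ξ : ι → E} (hξ : SynthesisBound ξ L) (hL : 0 ≤ L)
    (q : ι → ℝ) (p : ℕ) :
    ∫⁻ u, ∫⁻ v, ‖∑ i, q i * feat σ ξ s v i - ∑ i, q i * feat σ ξ s u i‖ₑ ^ (p + 1)
      ∂(stdGaussian E) ∂(stdGaussian E) ≤
      incrConst (p + 1) L b * Fintype.card ι * ENNReal.ofReal ((L * (b / s * l2 q)) ^ (p + 1)) := by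
  have hb := h.pos
  have hq := l2_nonneg q
  refine lintegral_comp_feat_sub_pow_le h hξ (Φ := fun a => ∑ i, q i * a i) (Γ := fun _ => q)
    continuous_const (by positivity) (fun a => ?_) (fun w Y hY => ?_) p
  · refine HasFDerivAt.fun_sum fun i _ => ?_
    exact (hasFDerivAt_apply i a).const_mul (q i)
  · refine (norm_featGrad_le h hs hξ hL _ hY).trans (le_of_eq ?_)
    ring

/-- Increments of quadratic forms in the features. -/
theorem lintegral_quadratic_sub_pow_le [Nonempty ι] {σ ψ : ℝ → ℝ} {b L s κ β : ℝ}
    (h : ExpDeriv σ ψ b) (hs : 0 < s) (hκ : (Fintype.card ι : ℝ) ≤ κ * s ^ 2)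
    {ξ : ι → E} (hξ : SynthesisBound ξ L) (hL : 0 ≤ L) {M : Matrix ι ι ℝ} (hM : M.IsSymm)
    (hβ : 0 ≤ β) (hMβ : ∀ a, l2 (M.mulVec a) ≤ β * l2 a) (p : ℕ) :
    ∫⁻ u, ∫⁻ v, ‖feat σ ξ s v ⬝ᵥ M.mulVec (feat σ ξ s v) -
        feat σ ξ s u ⬝ᵥ M.mulVec (feat σ ξ s u)‖ₑ ^ (p + 1)
      ∂(stdGaussian E) ∂(stdGaussian E) ≤
      incrConst (p + 1) L (2 * b) * Fintype.card ι *
        ENNReal.ofReal ((2 * L * √κ * b ^ 2 * β / s) ^ (p + 1)) := by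
  have hb := h.pos
  refine lintegral_comp_feat_sub_pow_le h hξ (Φ := fun a => a ⬝ᵥ M.mulVec a)
    (Γ := fun a i => 2 * M.mulVec a i) ?_ (by positivity) (fun a => ?_) (fun w Y hY => ?_) p
  · have : Continuous fun a : ι → ℝ => M.mulVec a := Continuous.matrix_mulVec continuous_const continuous_id
    fun_prop
  · have hd : HasFDerivAt (fun a : ι → ℝ => ∑ i, ∑ j, a i * (M i j * a j))
        (∑ i, ∑ j, (a i • (M i j • (ContinuousLinearMap.proj j : (ι → ℝ) →L[ℝ] ℝ)) +
          (M i j * a j) • (ContinuousLinearMap.proj i : (ι → ℝ) →L[ℝ] ℝ))) a := by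
      refine HasFDerivAt.fun_sum fun i _ => HasFDerivAt.fun_sum fun j _ => ?_
      exact (hasFDerivAt_apply i a).mul ((hasFDerivAt_apply j a).const_mul (M i j))
    have he : (fun a : ι → ℝ => a ⬝ᵥ M.mulVec a) = fun a => ∑ i, ∑ j, a i * (M i j * a j) := by
      ext a; simp [dotProduct, Matrix.mulVec, Finset.mul_sum]
    rw [he]
    refine hd.congr_fderiv ?_
    ext v
    simp only [sum_apply, add_apply, smul_apply, ContinuousLinearMap.proj_apply, smul_eq_mul,
      Finset.sum_add_distrib, Matrix.mulVec, dotProduct]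
    -- Interchanging the summation indices and using the symmetry of `M` merges the two halves of
    -- the derivative into `2 M a`.
    rw [Finset.sum_comm, ← Finset.sum_add_distrib]
    refine Finset.sum_congr rfl fun i _ => ?_
    rw [Finset.mul_sum, Finset.sum_mul, ← Finset.sum_add_distrib]
    refine Finset.sum_congr rfl fun j _ => ?_
    rw [hM.apply i j]
    ring
  · refine (norm_featGrad_le h hs hξ hL _ hY).trans ?_
    rw [l2_smul, abs_two]
    -- One factor `exp (b Y)` comes from `ψ` and one from the feature vector, hence the rate `2 *
    -- b`.
    have h2 := (hMβ (feat σ ξ s w)).trans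
      (mul_le_mul_of_nonneg_left (l2_feat_le h hs hκ hY) hβ)
    calc _ ≤ L * (b * Real.exp (b * Y) / s * (2 * (β * (√κ * (b * Real.exp (b * Y)))))) := by
          gcongr
      _ = _ := by
          rw [show 2 * b * Y = b * Y + b * Y by ring, Real.exp_add]; ring
end Envelope

/-! ### Growth and local Lipschitz bounds for the activation -/

theorem ennreal_add_pow_le (x y : ℝ≥0∞) (p : ℕ) : (x + y) ^ p ≤ 2 ^ p * (x ^ p + y ^ p) := by
  have h : x + y ≤ 2 * max x y := by
    rw [two_mul]; exact add_le_add (le_max_left _ _) (le_max_right _ _)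
  refine (pow_le_pow_left' h p).trans ?_
  rw [mul_pow]
  refine mul_le_mul_right ?_ _
  rcases max_cases x y with ⟨h, -⟩ | ⟨h, -⟩ <;> rw [h]
  · exact le_self_add
  · exact le_add_self

theorem abs_sub_le_of_deriv_bound {σ ψ : ℝ → ℝ} {S : Set ℝ} {B x y : ℝ} (hσ : Continuous σ)
    (hψ : Measurable ψ) (hS : S.Countable) (hd : ∀ t, t ∉ S → HasDerivAt σ (ψ t) t)
    (hB : ∀ t ∈ Set.uIcc x y, |ψ t| ≤ B) : |σ y - σ x| ≤ B * |y - x| := by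
  have hi : IntervalIntegrable ψ volume x y := by
    rw [intervalIntegrable_iff]
    refine Measure.integrableOn_of_bounded (M := B) (by simp) hψ.aestronglyMeasurable ?_
    filter_upwards [ae_restrict_mem measurableSet_uIoc] with t ht
    exact hB t (Set.uIoc_subset_uIcc ht)
  rw [← integral_eq_of_hasDerivAt_off_countable σ ψ hS hσ.continuousOn (fun t ht => hd t ht.2) hi]
  exact intervalIntegral.norm_integral_le_of_norm_le_const (f := ψ) (C := B) fun t ht =>
    hB t (Set.uIoc_subset_uIcc ht)

theorem ExpDeriv.abs_sub_le {σ ψ : ℝ → ℝ} {b r x y : ℝ} (h : ExpDeriv σ ψ b) (hx : |x| ≤ r)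
    (hy : |y| ≤ r) : |σ y - σ x| ≤ b * Real.exp (b * r) * |y - x| := by
  obtain ⟨S, hS, hd⟩ := h.hasDerivAt
  have hb := h.pos
  refine abs_sub_le_of_deriv_bound h.continuous h.measurable hS hd fun t ht => ?_
  refine (h.deriv_bound t).trans ?_
  gcongr
  have : Set.uIcc x y ⊆ Set.Icc (-r) r :=
    Set.uIcc_subset_Icc (abs_le.1 hx) (abs_le.1 hy)
  exact abs_le.2 (this ht)

theorem IsActivation.exists_expDeriv {σ : ℝ → ℝ} {C₀ C₁ : ℝ} (h : IsActivation σ C₀ C₁) :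
    ∃ ψ b, ExpDeriv σ ψ b := by
  obtain ⟨S, hS, hd⟩ := h.deriv_bound
  have h0 := h.nonneg_C₀
  have h1 := h.nonneg_C₁
  classical
  -- The derivative is cut off where the bound fails, which happens only on `S`; this makes the
  -- bound hold everywhere without changing `ψ` off `S`.
  let ψ : ℝ → ℝ := fun t => if |deriv σ t| ≤ C₀ * Real.exp (C₁ * |t|) then deriv σ t else 0
  have hψm : Measurable ψ := by
    have := measurable_deriv σ
    refine Measurable.ite (measurableSet_le (by fun_prop) (by fun_prop)) this measurable_const
  have hψb : ∀ t, |ψ t| ≤ C₀ * Real.exp (C₁ * |t|) := by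
    intro t
    simp only [ψ]
    split_ifs with ht
    · exact ht
    · simp; positivity
  have hψd : ∀ t, t ∉ S → HasDerivAt σ (ψ t) t := by
    intro t ht
    simp only [ψ, if_pos (hd t ht).2]
    exact (hd t ht).1.hasDerivAt
  have hb : C₀ + C₁ + |σ 0| + 1 ≥ C₀ + 0 := by linarith [abs_nonneg (σ 0)]
  -- The single constant serves as factor and as rate. The summand `1` in the rate absorbs the
  -- linear factor in `|σ t| ≤ |σ 0| + C₀ e^{C₁|t|} |t|` through `|t| ≤ e^{|t|}`.
  refine ⟨ψ, C₀ + C₁ + |σ 0| + 1, h.continuous, hψm, by positivity, fun t => ?_, fun t => ?_,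
    S, hS, hψd⟩
  · have h2 : |σ t - σ 0| ≤ C₀ * Real.exp (C₁ * |t|) * |t - 0| := by
      refine abs_sub_le_of_deriv_bound h.continuous hψm hS hψd fun r hr => (hψb r).trans ?_
      refine mul_le_mul_of_nonneg_left (Real.exp_le_exp.2 (mul_le_mul_of_nonneg_left ?_ h1)) h0
      have := Set.uIcc_subset_Icc (a₁ := 0) (b₁ := t) (a₂ := -|t|) (b₂ := |t|)
        (by simp) ⟨neg_abs_le t, le_abs_self t⟩ hr
      exact abs_le.2 this
    have h3 : |t| ≤ Real.exp |t| := by linarith [Real.add_one_le_exp |t|]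
    have h4 : |σ t| ≤ |σ 0| + C₀ * Real.exp (C₁ * |t|) * |t| := by
      have := abs_sub_abs_le_abs_sub (σ t) (σ 0)
      rw [sub_zero] at h2
      linarith
    have h5 : Real.exp (C₁ * |t|) * Real.exp |t| ≤
        Real.exp ((C₀ + C₁ + |σ 0| + 1) * |t|) := by
      rw [← Real.exp_add]
      refine Real.exp_le_exp.2 ?_
      nlinarith [abs_nonneg t, abs_nonneg (σ 0), mul_nonneg h0 (abs_nonneg t),
        mul_nonneg (abs_nonneg (σ 0)) (abs_nonneg t)]
    have h6 : 1 ≤ Real.exp ((C₀ + C₁ + |σ 0| + 1) * |t|) := Real.one_le_exp (by positivity)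
    calc |σ t| ≤ |σ 0| * 1 + C₀ * (Real.exp (C₁ * |t|) * |t|) := by linarith
      _ ≤ |σ 0| * Real.exp ((C₀ + C₁ + |σ 0| + 1) * |t|) +
          C₀ * Real.exp ((C₀ + C₁ + |σ 0| + 1) * |t|) :=
          add_le_add (mul_le_mul_of_nonneg_left h6 (abs_nonneg _)) (mul_le_mul_of_nonneg_left
            ((mul_le_mul_of_nonneg_left h3 (Real.exp_pos _).le).trans h5) h0)
      _ ≤ _ := by
          rw [← add_mul]
          exact mul_le_mul_of_nonneg_right (by linarith) (Real.exp_pos _).le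
  · refine (hψb t).trans ?_
    gcongr
    · linarith
    · linarith [abs_nonneg (σ 0)]

/-! ### Centring of the features, and bilinear forms in independent feature vectors -/

section Mean
/-- Constant in the bound for the mean of a feature. -/
noncomputable def meanConst (b L : ℝ) : ℝ :=
  b * (2 * Real.exp ((b * (L + 1) + 1) ^ 2 / 2))

theorem ExpDeriv.integrable_gaussianReal {σ ψ : ℝ → ℝ} {b : ℝ} (h : ExpDeriv σ ψ b) (v : ℝ≥0) :
    Integrable σ (gaussianReal 0 v) := by
  refine ⟨h.continuous.aestronglyMeasurable, ?_⟩
  have hb := h.pos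
  calc ∫⁻ t, ‖σ t‖ₑ ∂(gaussianReal 0 v)
      ≤ ∫⁻ t, ENNReal.ofReal b * ENNReal.ofReal (Real.exp (b * |t|)) ∂(gaussianReal 0 v) := by
        refine lintegral_mono fun t => ?_
        rw [← ENNReal.ofReal_mul hb.le, ← ofReal_norm]
        exact ENNReal.ofReal_le_ofReal (h.bound t)
    _ = ENNReal.ofReal b * ∫⁻ t, ENNReal.ofReal (Real.exp (b * |t|)) ∂(gaussianReal 0 v) :=
        lintegral_const_mul' _ _ ENNReal.ofReal_ne_top
    _ < ⊤ := ENNReal.mul_lt_top ENNReal.ofReal_lt_top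
        ((lintegral_exp_abs_gaussianReal_le v b).trans_lt ENNReal.ofReal_lt_top)

/-- Subtracting `∫ σ = 0` leaves `σ (t x) - σ x`, and the local Lipschitz bound produces the factor
`|t - 1|`. Both arguments lie within `(L + 1) |x|`, which gives the exponent in `meanConst`. -/
theorem abs_integral_le_of_centred {σ ψ : ℝ → ℝ} {b L t : ℝ} (h : ExpDeriv σ ψ b)
    (hσ : ∫ x, σ x ∂(gaussianReal 0 1) = 0) (ht : 0 ≤ t) (htL : t ≤ L) :
    |∫ x, σ (t * x) ∂(gaussianReal 0 1)| ≤ meanConst b L * |t - 1| := by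
  have hb := h.pos
  have hint : Integrable (fun x => σ (t * x)) (gaussianReal 0 1) := by
    have h2 := h.integrable_gaussianReal (NNReal.mk (t ^ 2) (sq_nonneg t))
    have h3 : gaussianReal 0 (NNReal.mk (t ^ 2) (sq_nonneg t)) = (gaussianReal 0 1).map (t * ·) := by
      rw [gaussianReal_map_const_mul]; simp
    rw [h3] at h2
    exact h2.comp_measurable (by fun_prop)
  have hint1 : Integrable σ (gaussianReal 0 1) := h.integrable_gaussianReal 1
  have h1 : ∫ x, σ (t * x) ∂(gaussianReal 0 1) =
      ∫ x, (σ (t * x) - σ x) ∂(gaussianReal 0 1) := by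
    rw [integral_sub hint hint1, hσ, sub_zero]
  have hpt : ∀ x, |σ (t * x) - σ x| ≤
      b * |t - 1| * Real.exp ((b * (L + 1) + 1) * |x|) := by
    intro x
    have hr1 : |x| ≤ (L + 1) * |x| := by nlinarith [abs_nonneg x]
    have hr2 : |t * x| ≤ (L + 1) * |x| := by
      rw [abs_mul, abs_of_nonneg ht]; nlinarith [abs_nonneg x]
    refine (h.abs_sub_le hr1 hr2).trans ?_
    rw [show t * x - x = (t - 1) * x by ring, abs_mul]
    have h3 : |x| ≤ Real.exp |x| := by linarith [Real.add_one_le_exp |x|]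
    calc b * Real.exp (b * ((L + 1) * |x|)) * (|t - 1| * |x|)
        = b * |t - 1| * (Real.exp (b * ((L + 1) * |x|)) * |x|) := by ring
      _ ≤ b * |t - 1| * (Real.exp (b * ((L + 1) * |x|)) * Real.exp |x|) := by gcongr
      _ = _ := by rw [← Real.exp_add]; ring_nf
  rw [h1]
  have h5 : ENNReal.ofReal |∫ x, (σ (t * x) - σ x) ∂(gaussianReal 0 1)| ≤
      ENNReal.ofReal (meanConst b L * |t - 1|) := by
    calc ENNReal.ofReal |∫ x, (σ (t * x) - σ x) ∂(gaussianReal 0 1)|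
        ≤ ∫⁻ x, ‖σ (t * x) - σ x‖ₑ ∂(gaussianReal 0 1) := by
          rw [← Real.norm_eq_abs, ofReal_norm]
          exact enorm_integral_le_lintegral_enorm _
      _ ≤ ∫⁻ x, ENNReal.ofReal (b * |t - 1|) *
          ENNReal.ofReal (Real.exp ((b * (L + 1) + 1) * |x|)) ∂(gaussianReal 0 1) := by
          refine lintegral_mono fun x => ?_
          rw [← ENNReal.ofReal_mul (by positivity), ← ofReal_norm]
          exact ENNReal.ofReal_le_ofReal (hpt x)
      _ ≤ ENNReal.ofReal (b * |t - 1|) *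
          ENNReal.ofReal (2 * Real.exp ((b * (L + 1) + 1) ^ 2 / 2)) := by
          rw [lintegral_const_mul' _ _ ENNReal.ofReal_ne_top]
          refine mul_le_mul_right ((lintegral_exp_abs_gaussianReal_le 1 _).trans (le_of_eq ?_)) _
          simp
      _ = _ := by
          rw [← ENNReal.ofReal_mul (by positivity), meanConst]; ring_nf
  refine (ENNReal.ofReal_le_ofReal_iff ?_).1 h5
  unfold meanConst; positivity

variable {E : Type*} [NormedAddCommGroup E] [InnerProductSpace ℝ E] [FiniteDimensional ℝ E]
  [MeasurableSpace E] [BorelSpace E]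

theorem integral_comp_inner {σ : ℝ → ℝ} (hσ : Continuous σ) (x : E) :
    ∫ w, σ ⟪x, w⟫ ∂(stdGaussian E) = ∫ t, σ (‖x‖ * t) ∂(gaussianReal 0 1) := by
  have h1 : ∫ w, σ ⟪x, w⟫ ∂(stdGaussian E) = ∫ t, σ t ∂(gaussianReal 0 (‖x‖₊ ^ 2)) := by
    rw [← map_inner_stdGaussian, integral_map (by fun_prop) hσ.aestronglyMeasurable]
  have h2 : gaussianReal 0 (‖x‖₊ ^ 2) = (gaussianReal 0 1).map (fun t => ‖x‖ * t) := by
    rw [gaussianReal_map_const_mul]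
    congr 1
    · simp
    · ext; simp
  rw [h1, h2, integral_map (by fun_prop) hσ.aestronglyMeasurable]

theorem ExpDeriv.integrable_comp_inner {σ ψ : ℝ → ℝ} {b : ℝ} (h : ExpDeriv σ ψ b) (x : E) :
    Integrable (fun w => σ ⟪x, w⟫) (stdGaussian E) := by
  have h2 := h.integrable_gaussianReal (‖x‖₊ ^ 2)
  rw [← map_inner_stdGaussian] at h2
  exact h2.comp_measurable (by fun_prop)

variable {ι : Type*} [Fintype ι]

/-- Constant in the moment bound for bilinear forms in two independent feature vectors. -/
noncomputable def bilinConst (p : ℕ) (L b κ : ℝ) : ℝ≥0∞ :=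
  2 ^ p * (incrConst p L b * ENNReal.ofReal ((L * b) ^ p) +
    ENNReal.ofReal ((√κ * meanConst b L) ^ p)) *
    (ENNReal.ofReal ((√κ * b) ^ p) * ENNReal.ofReal (2 * Real.exp (L ^ 2 * (b * p) ^ 2 / 2)))

theorem bilinConst_lt_top (p : ℕ) (L b κ : ℝ) : bilinConst p L b κ < ⊤ := by
  unfold bilinConst
  have := incrConst_lt_top p L b
  refine ENNReal.mul_lt_top (ENNReal.mul_lt_top (by simp) (ENNReal.add_lt_top.2 ⟨?_, by simp⟩))
    (ENNReal.mul_lt_top (by simp) ENNReal.ofReal_lt_top)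
  exact ENNReal.mul_lt_top this (by simp)

/-- The form is split into its mean and its fluctuation. The fluctuation is of size `l2 q / s`; the
mean is a pairing of `q` with a vector of norm of order `τ`. Both are of order `τ * l2 q` because `1
/ s ≤ τ`. -/
theorem lintegral_linear_pow_le [Nonempty ι] {σ ψ : ℝ → ℝ} {b L s κ τ : ℝ}
    (h : ExpDeriv σ ψ b) (hσ : ∫ x, σ x ∂(gaussianReal 0 1) = 0) (hs : 0 < s)
    (hκ : (Fintype.card ι : ℝ) ≤ κ * s ^ 2)
    {ξ : ι → E} (hξ : SynthesisBound ξ L) (hL : 0 ≤ L) (hτ : 1 / s ≤ τ)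
    (hnorm : ∀ i, |‖ξ i‖ ^ 2 - 1| ≤ τ) (q : ι → ℝ) (p : ℕ) :
    ∫⁻ u, ‖∑ i, q i * feat σ ξ s u i‖ₑ ^ (p + 1) ∂(stdGaussian E) ≤
      2 ^ (p + 1) * (incrConst (p + 1) L b * ENNReal.ofReal ((L * b) ^ (p + 1)) +
        ENNReal.ofReal ((√κ * meanConst b L) ^ (p + 1))) * Fintype.card ι *
        ENNReal.ofReal ((τ * l2 q) ^ (p + 1)) := by
  have hb := h.pos
  have hq := l2_nonneg q
  have hτ0 : 0 < τ := lt_of_lt_of_le (by positivity) hτ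
  set γ := stdGaussian E
  set f : E → ℝ := fun u => ∑ i, q i * feat σ ξ s u i with hf
  have hfi : Integrable f γ := integrable_finsetSum _ fun i _ =>
    ((h.integrable_comp_inner (ξ i)).div_const s).const_mul _
  have hmean : |∫ v, f v ∂γ| ≤ √κ * meanConst b L * (τ * l2 q) := by
    have h1 : ∫ v, f v ∂γ = ∑ i, q i * ((∫ t, σ (‖ξ i‖ * t) ∂(gaussianReal 0 1)) / s) := by
      have hI : ∀ i ∈ Finset.univ, Integrable (fun v => q i * feat σ ξ s v i) γ := fun i _ =>
        ((h.integrable_comp_inner (ξ i)).div_const s).const_mul _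
      simp only [hf]
      rw [integral_finsetSum _ hI]
      refine Finset.sum_congr rfl fun i _ => ?_
      simp only [feat]
      rw [integral_const_mul, integral_div, integral_comp_inner h.continuous]
    rw [h1]
    refine (abs_sum_mul_le_l2 _ _).trans ?_
    have hm0 : 0 ≤ meanConst b L := by unfold meanConst; positivity
    have h2 : l2 (fun i => (∫ t, σ (‖ξ i‖ * t) ∂(gaussianReal 0 1)) / s) ≤
        √(Fintype.card ι) * (meanConst b L * τ / s) := by
      refine l2_le_sqrt_card_mul (by positivity) fun i => ?_
      rw [abs_div, abs_of_pos hs]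
      refine div_le_div_of_nonneg_right ?_ hs.le
      refine (abs_integral_le_of_centred h hσ (norm_nonneg _) (hξ.norm_le i)).trans ?_
      refine mul_le_mul_of_nonneg_left (le_trans ?_ (hnorm i)) hm0
      rw [show ‖ξ i‖ ^ 2 - 1 = (‖ξ i‖ + 1) * (‖ξ i‖ - 1) by ring, abs_mul,
        abs_of_pos (by positivity : 0 < ‖ξ i‖ + 1)]
      -- Since `‖ξ i‖ + 1 ≥ 1`, the deviation of the norm is at most that of its square.
      nlinarith [abs_nonneg (‖ξ i‖ - 1), norm_nonneg (ξ i)]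
    have h3 : √(Fintype.card ι : ℝ) ≤ √κ * s := by
      rw [← Real.sqrt_sq hs.le, ← Real.sqrt_mul' _ (sq_nonneg s)]
      exact Real.sqrt_le_sqrt hκ
    calc _ ≤ l2 q * (√κ * s * (meanConst b L * τ / s)) := by gcongr; exact h2.trans (by gcongr)
      _ = _ := by field_simp
  have hA : ∫⁻ u, ‖f u - ∫ v, f v ∂γ‖ₑ ^ (p + 1) ∂γ ≤ incrConst (p + 1) L b * Fintype.card ι *
      (ENNReal.ofReal ((L * b) ^ (p + 1)) * ENNReal.ofReal ((τ * l2 q) ^ (p + 1))) := by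
    refine (lintegral_sub_integral_pow_le γ hfi p).trans
      ((lintegral_linear_sub_pow_le h hs hξ hL q p).trans ?_)
    rw [← ENNReal.ofReal_mul (by positivity), ← mul_pow]
    refine mul_le_mul_right (ENNReal.ofReal_le_ofReal (pow_le_pow_left₀ (by positivity) ?_ _)) _
    calc L * (b / s * l2 q) = L * b * (1 / s * l2 q) := by ring
      _ ≤ _ := by gcongr
  have hB : ‖∫ v, f v ∂γ‖ₑ ^ (p + 1) ≤ Fintype.card ι *
      (ENNReal.ofReal ((√κ * meanConst b L) ^ (p + 1)) *
        ENNReal.ofReal ((τ * l2 q) ^ (p + 1))) := by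
    have hm0 : 0 ≤ meanConst b L := by unfold meanConst; positivity
    rw [← ENNReal.ofReal_mul (by positivity), ← mul_pow, ← ofReal_norm,
      ← ENNReal.ofReal_pow (norm_nonneg _)]
    refine le_trans ?_ (le_mul_of_one_le_left' (by exact_mod_cast Fintype.card_pos))
    exact ENNReal.ofReal_le_ofReal (pow_le_pow_left₀ (norm_nonneg _) hmean _)
  calc ∫⁻ u, ‖f u‖ₑ ^ (p + 1) ∂γ
      ≤ ∫⁻ u, 2 ^ (p + 1) * (‖f u - ∫ v, f v ∂γ‖ₑ ^ (p + 1) + ‖∫ v, f v ∂γ‖ₑ ^ (p + 1)) ∂γ := by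
        refine lintegral_mono fun u => ?_
        have h1 : ‖f u‖ₑ ≤ ‖f u - ∫ v, f v ∂γ‖ₑ + ‖∫ v, f v ∂γ‖ₑ := by
          simpa using enorm_add_le (f u - ∫ v, f v ∂γ) (∫ v, f v ∂γ)
        exact (pow_le_pow_left' h1 _).trans (ennreal_add_pow_le _ _ _)
    _ = 2 ^ (p + 1) * (∫⁻ u, ‖f u - ∫ v, f v ∂γ‖ₑ ^ (p + 1) ∂γ + ‖∫ v, f v ∂γ‖ₑ ^ (p + 1)) := by
        rw [lintegral_const_mul' _ _ (by simp), lintegral_add_right _ measurable_const]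
        simp
    _ ≤ 2 ^ (p + 1) * _ := mul_le_mul_right (add_le_add hA hB) _
    _ = _ := by ring

/-- Bilinear forms in two independent feature vectors. -/
theorem lintegral_bilinear_pow_le [Nonempty ι] {σ ψ : ℝ → ℝ} {b L s κ τ β : ℝ}
    (h : ExpDeriv σ ψ b) (hσ : ∫ x, σ x ∂(gaussianReal 0 1) = 0) (hs : 0 < s)
    (hκ : (Fintype.card ι : ℝ) ≤ κ * s ^ 2)
    {ξ : ι → E} (hξ : SynthesisBound ξ L) (hL : 0 ≤ L) (hτ : 1 / s ≤ τ)
    (hnorm : ∀ i, |‖ξ i‖ ^ 2 - 1| ≤ τ) {M : Matrix ι ι ℝ}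
    (hβ : 0 ≤ β) (hMβ : ∀ a, l2 (M.mulVec a) ≤ β * l2 a) (p : ℕ) :
    ∫⁻ v, ∫⁻ u, ‖feat σ ξ s u ⬝ᵥ M.mulVec (feat σ ξ s v)‖ₑ ^ (p + 1)
      ∂(stdGaussian E) ∂(stdGaussian E) ≤
      bilinConst (p + 1) L b κ * Fintype.card ι ^ 2 * ENNReal.ofReal ((β * τ) ^ (p + 1)) := by
  have hb := h.pos
  have hτ0 : 0 < τ := lt_of_lt_of_le (by positivity) hτ
  set K := 2 ^ (p + 1) * (incrConst (p + 1) L b * ENNReal.ofReal ((L * b) ^ (p + 1)) +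
        ENNReal.ofReal ((√κ * meanConst b L) ^ (p + 1))) with hK
  have hKtop : K ≠ ⊤ := by
    have := incrConst_lt_top (p + 1) L b
    refine (ENNReal.mul_lt_top (by simp) (ENNReal.add_lt_top.2 ⟨?_, by simp⟩)).ne
    exact ENNReal.mul_lt_top this (by simp)
  have hcard : (Fintype.card ι : ℝ≥0∞) ≠ ⊤ := by simp
  calc _ ≤ ∫⁻ v, K * Fintype.card ι * (ENNReal.ofReal ((β * τ) ^ (p + 1)) *
          ENNReal.ofReal ((√κ * b) ^ (p + 1))) *
          ENNReal.ofReal (envelope ξ (b * (p + 1 : ℕ)) v) ∂(stdGaussian E) := by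
        refine lintegral_mono fun v => ?_
        -- For fixed `v` this is a linear form in the features of `u`, with coefficients `M (feat
        -- v)`; integrating their norm over `v` costs a second factor `Fintype.card ι`.
        have h1 := lintegral_linear_pow_le h hσ hs hκ hξ hL hτ hnorm
          (M.mulVec (feat σ ξ s v)) p
        simp_rw [dotProduct, mul_comm (feat σ ξ s _ _)]
        refine h1.trans ?_
        rw [← hK, mul_assoc (K * _)]
        refine mul_le_mul_right ?_ _
        rw [← ENNReal.ofReal_mul (by positivity), ← ENNReal.ofReal_mul (by positivity)]
        refine ENNReal.ofReal_le_ofReal ?_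
        obtain ⟨Y, hY, hYe⟩ := exists_envelope ξ v
        have h2 : τ * l2 (M.mulVec (feat σ ξ s v)) ≤
            β * τ * (√κ * b) * Real.exp (b * Y) := by
          calc τ * l2 (M.mulVec (feat σ ξ s v)) ≤ τ * (β * (√κ * (b * Real.exp (b * Y)))) := by
                gcongr
                exact (hMβ _).trans (mul_le_mul_of_nonneg_left (l2_feat_le h hs hκ hY) hβ)
            _ = _ := by ring
        refine (pow_le_pow_left₀ (mul_nonneg hτ0.le (l2_nonneg _)) h2 _).trans ?_
        rw [mul_pow, mul_pow (β * τ)]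
        refine mul_le_mul_of_nonneg_left ?_ (by positivity)
        rw [← Real.exp_nat_mul]
        refine le_trans (le_of_eq ?_) (hYe (b * (p + 1 : ℕ)))
        ring_nf
    _ = K * Fintype.card ι * (ENNReal.ofReal ((β * τ) ^ (p + 1)) *
          ENNReal.ofReal ((√κ * b) ^ (p + 1))) *
          ∫⁻ v, ENNReal.ofReal (envelope ξ (b * (p + 1 : ℕ)) v) ∂(stdGaussian E) :=
        lintegral_const_mul' _ _ (ENNReal.mul_ne_top (ENNReal.mul_ne_top hKtop hcard)
          (ENNReal.mul_ne_top ENNReal.ofReal_ne_top ENNReal.ofReal_ne_top))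
    _ ≤ _ := mul_le_mul_right (lintegral_envelope_le hξ _) _
    _ = _ := by rw [bilinConst, hK]; ring
end Mean

/-! ### Resolvent bounds and the Schur complement of two columns -/

section Resolvent
variable {m : ℕ}

/-- The matrix `M - z I` over `ℂ`. -/
noncomputable def shifted (M : Matrix (Fin m) (Fin m) ℝ) (z : ℂ) : Matrix (Fin m) (Fin m) ℂ :=
  M.map (fun x : ℝ => (x : ℂ)) - z • (1 : Matrix (Fin m) (Fin m) ℂ)

/-- The form of the real symmetric `M` is real, so the imaginary part of `⟨y, (M - z) y⟩` is `-η
‖y‖²`; Cauchy–Schwarz finishes. Invertibility and the bound `η⁻¹` on the resolvent follow. -/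
theorem im_mul_norm_le_shifted {M : Matrix (Fin m) (Fin m) ℝ} (hM : M.IsSymm) {z : ℂ}
    (y : Fin m → ℂ) :
    z.im * ‖WithLp.toLp 2 y‖ ≤ ‖WithLp.toLp 2 ((shifted M z).mulVec y)‖ := by
  set Y : EuclideanSpace ℂ (Fin m) := WithLp.toLp 2 y
  set V : EuclideanSpace ℂ (Fin m) := WithLp.toLp 2 ((shifted M z).mulVec y)
  have hherm : (M.map (fun x : ℝ => (x : ℂ))).IsHermitian := by
    ext i j
    simp [Matrix.conjTranspose_apply, hM.apply i j]
  have him : (star y ⬝ᵥ (M.map (fun x : ℝ => (x : ℂ))).mulVec y).im = 0 :=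
    hherm.im_star_dotProduct_mulVec_self y
  have h1 : inner ℂ Y V = star y ⬝ᵥ (M.map (fun x : ℝ => (x : ℂ))).mulVec y - z * (‖Y‖ : ℂ) ^ 2 := by
    have h2 : inner ℂ Y V = star y ⬝ᵥ (shifted M z).mulVec y := by
      rw [EuclideanSpace.inner_eq_star_dotProduct, dotProduct_comm]
    have h3 : (‖Y‖ : ℂ) ^ 2 = star y ⬝ᵥ y := by
      have h5 := inner_self_eq_norm_sq_to_K (𝕜 := ℂ) Y
      rw [EuclideanSpace.inner_eq_star_dotProduct, dotProduct_comm] at h5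
      exact h5.symm
    rw [h2, h3, shifted, Matrix.sub_mulVec, Matrix.smul_mulVec, Matrix.one_mulVec,
      dotProduct_sub, dotProduct_smul, smul_eq_mul]
  have h4 : (inner ℂ Y V).im = - (z.im * ‖Y‖ ^ 2) := by
    rw [h1, Complex.sub_im, him, ← Complex.ofReal_pow, Complex.im_mul_ofReal]; ring
  have h5 : z.im * ‖Y‖ ^ 2 ≤ ‖Y‖ * ‖V‖ := by
    have := (Complex.abs_im_le_norm (inner ℂ Y V)).trans (norm_inner_le_norm Y V)
    rw [h4, abs_neg] at this
    exact (le_abs_self _).trans this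
  rcases (norm_nonneg Y).eq_or_lt with h0 | h0
  · rw [← h0, mul_zero]; exact norm_nonneg _
  · nlinarith

theorem isUnit_det_shifted {M : Matrix (Fin m) (Fin m) ℝ} (hM : M.IsSymm) {z : ℂ}
    (hz : 0 < z.im) : IsUnit (shifted M z).det := by
  rw [isUnit_iff_ne_zero]
  intro h
  obtain ⟨y, hy, h0⟩ := Matrix.exists_mulVec_eq_zero_iff.2 h
  have := im_mul_norm_le_shifted hM (z := z) y
  rw [h0] at this
  have h2 : ‖WithLp.toLp 2 y‖ ≤ 0 := by
    have h3 : z.im * ‖WithLp.toLp 2 y‖ ≤ 0 := by simpa using this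
    by_contra hc
    push Not at hc
    nlinarith
  have h3 := norm_le_zero_iff.1 h2
  exact hy (by simpa using h3)

theorem shifted_mul_resolvent {M : Matrix (Fin m) (Fin m) ℝ} (hM : M.IsSymm) {z : ℂ}
    (hz : 0 < z.im) : shifted M z * resolvent M z = 1 :=
  Matrix.mul_nonsing_inv _ (isUnit_det_shifted hM hz)

theorem resolvent_mul_shifted {M : Matrix (Fin m) (Fin m) ℝ} (hM : M.IsSymm) {z : ℂ}
    (hz : 0 < z.im) : resolvent M z * shifted M z = 1 :=
  Matrix.nonsing_inv_mul _ (isUnit_det_shifted hM hz)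

theorem resolvent_isSymm {M : Matrix (Fin m) (Fin m) ℝ} (hM : M.IsSymm) (z : ℂ) :
    (resolvent M z).IsSymm := by
  have h : (shifted M z).IsSymm := by
    ext i j
    simp [shifted, Matrix.one_apply, hM.apply i j, eq_comm]
  rw [Matrix.IsSymm, resolvent, Matrix.transpose_nonsing_inv]
  exact congrArg _ h

theorem norm_resolvent_mulVec_le {M : Matrix (Fin m) (Fin m) ℝ} (hM : M.IsSymm) {z : ℂ}
    (hz : 0 < z.im) (v : Fin m → ℂ) :
    ‖WithLp.toLp 2 ((resolvent M z).mulVec v)‖ ≤ z.im⁻¹ * ‖WithLp.toLp 2 v‖ := by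
  have h := im_mul_norm_le_shifted hM (z := z) ((resolvent M z).mulVec v)
  rw [Matrix.mulVec_mulVec, shifted_mul_resolvent hM hz, Matrix.one_mulVec] at h
  rw [inv_mul_eq_div, le_div_iff₀ hz, mul_comm]
  exact h

theorem norm_resolvent_apply_le {M : Matrix (Fin m) (Fin m) ℝ} (hM : M.IsSymm) {z : ℂ}
    (hz : 0 < z.im) (i j : Fin m) : ‖resolvent M z i j‖ ≤ z.im⁻¹ := by
  have h := norm_resolvent_mulVec_le hM hz (Pi.single j 1)
  have h2 : ‖WithLp.toLp 2 (Pi.single j (1 : ℂ) : Fin m → ℂ)‖ = 1 := by simp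
  rw [h2, mul_one] at h
  refine le_trans ?_ h
  have := PiLp.norm_apply_le (WithLp.toLp 2 ((resolvent M z).mulVec (Pi.single j (1 : ℂ)))) i
  simpa using this

/-- The real part of the resolvent. -/
noncomputable def resolventRe (M : Matrix (Fin m) (Fin m) ℝ) (z : ℂ) : Matrix (Fin m) (Fin m) ℝ :=
  (resolvent M z).map Complex.re

/-- The imaginary part of the resolvent. -/
noncomputable def resolventIm (M : Matrix (Fin m) (Fin m) ℝ) (z : ℂ) : Matrix (Fin m) (Fin m) ℝ :=
  (resolvent M z).map Complex.im

theorem resolventRe_isSymm {M : Matrix (Fin m) (Fin m) ℝ} (hM : M.IsSymm) (z : ℂ) :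
    (resolventRe M z).IsSymm := (resolvent_isSymm hM z).map _

theorem resolventIm_isSymm {M : Matrix (Fin m) (Fin m) ℝ} (hM : M.IsSymm) (z : ℂ) :
    (resolventIm M z).IsSymm := (resolvent_isSymm hM z).map _

theorem resolvent_mulVec_ofReal (M : Matrix (Fin m) (Fin m) ℝ) (z : ℂ) (a : Fin m → ℝ)
    (i : Fin m) : (resolvent M z).mulVec (fun j => (a j : ℂ)) i =
      ((resolventRe M z).mulVec a i : ℂ) + ((resolventIm M z).mulVec a i : ℂ) * Complex.I := by
  simp only [Matrix.mulVec, dotProduct, resolventRe, resolventIm, Matrix.map_apply]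
  push_cast
  rw [Finset.sum_mul, ← Finset.sum_add_distrib]
  refine Finset.sum_congr rfl fun j _ => ?_
  nth_rewrite 1 [← Complex.re_add_im (resolvent M z i j)]
  ring

/-- For real `a` the squared norm of the image is the sum of the squares for the real and imaginary
parts. The concentration bounds concern real forms, so each part is treated as a real symmetric
matrix. -/
theorem l2_resolvent_parts_le {M : Matrix (Fin m) (Fin m) ℝ} (hM : M.IsSymm) {z : ℂ}
    (hz : 0 < z.im) (a : Fin m → ℝ) :
    l2 ((resolventRe M z).mulVec a) ≤ z.im⁻¹ * l2 a ∧
      l2 ((resolventIm M z).mulVec a) ≤ z.im⁻¹ * l2 a := by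
  have h := norm_resolvent_mulVec_le hM hz (fun j => (a j : ℂ))
  have h1 : ‖WithLp.toLp 2 (fun j => (a j : ℂ))‖ = l2 a := by
    rw [EuclideanSpace.norm_eq, l2]; simp
  have h2 : ∀ i, ‖(resolvent M z).mulVec (fun j => (a j : ℂ)) i‖ ^ 2 =
      (resolventRe M z).mulVec a i ^ 2 + (resolventIm M z).mulVec a i ^ 2 := by
    intro i
    rw [resolvent_mulVec_ofReal, ← Complex.normSq_eq_norm_sq, Complex.normSq_add_mul_I]
  rw [h1, EuclideanSpace.norm_eq] at h
  simp only [h2] at h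
  refine ⟨le_trans (Real.sqrt_le_sqrt ?_) h, le_trans (Real.sqrt_le_sqrt ?_) h⟩
  · exact Finset.sum_le_sum fun i _ => le_add_of_nonneg_right (sq_nonneg _)
  · exact Finset.sum_le_sum fun i _ => le_add_of_nonneg_left (sq_nonneg _)

variable {k : ℕ}

/-- The matrix `A` with the columns `α` and `β` replaced by zero. -/
def dropCols (A : Matrix (Fin m) (Fin k) ℝ) (α β : Fin k) : Matrix (Fin m) (Fin k) ℝ :=
  Matrix.of fun a γ => if γ = α ∨ γ = β then 0 else A a γ

/-- The quadratic form of the resolvent of `A' A'ᵀ` on the columns of `A`, where `A'` lacks the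
columns `α` and `β`. -/
noncomputable def colForm (A : Matrix (Fin m) (Fin k) ℝ) (z : ℂ) (α β : Fin k) :
    Matrix (Fin k) (Fin k) ℂ :=
  (A.map (fun x : ℝ => (x : ℂ))).transpose *
    (resolvent (dropCols A α β * (dropCols A α β).transpose) z * A.map (fun x : ℝ => (x : ℂ)))

/-- For `i` in `{α, β}` this is the 2 × 2 identity "block of `R` times `-z (1 + Q)` equals `1`",
with `Q` the form of the reduced resolvent on the two columns. -/
theorem resolvent_block_eq (A : Matrix (Fin m) (Fin k) ℝ) {z : ℂ} (hz : 0 < z.im)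
    {α β : Fin k} (hαβ : α ≠ β) {l : Fin k} (hl : l = α ∨ l = β) (i : Fin k) :
    (1 : Matrix (Fin k) (Fin k) ℂ) l i = -z * (resolvent (A.transpose * A) z l i +
      resolvent (A.transpose * A) z l α * colForm A z α β α i +
      resolvent (A.transpose * A) z l β * colForm A z α β β i) := by
  set B := dropCols A α β with hB
  set c : Matrix (Fin m) (Fin k) ℂ := A.map (fun x : ℝ => (x : ℂ)) with hc
  set c' : Matrix (Fin m) (Fin k) ℂ := B.map (fun x : ℝ => (x : ℂ)) with hc'
  set P := resolvent (B * B.transpose) z with hP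
  set R := resolvent (A.transpose * A) z with hR
  have hsA : (A.transpose * A).IsSymm := by simp [Matrix.IsSymm, Matrix.transpose_mul]
  have hsB : (B * B.transpose).IsSymm := by simp [Matrix.IsSymm, Matrix.transpose_mul]
  have hP1 : c' * c'.transpose * P = 1 + z • P := by
    have h := shifted_mul_resolvent hsB hz
    have h2 : (B * B.transpose).map (fun x : ℝ => (x : ℂ)) = c' * c'.transpose := by
      ext i j; simp [Matrix.mul_apply, hc']
    rw [shifted, h2, Matrix.sub_mul, Matrix.smul_mul, Matrix.one_mul, sub_eq_iff_eq_add] at h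
    exact h
  have hR1 : R * (c.transpose * c - z • (1 : Matrix (Fin k) (Fin k) ℂ)) = 1 := by
    have h := resolvent_mul_shifted hsA hz
    have h2 : (A.transpose * A).map (fun x : ℝ => (x : ℂ)) = c.transpose * c := by
      ext i j; simp [Matrix.mul_apply, hc]
    rw [shifted, h2] at h
    exact h
  -- The dropped columns of `c` only meet zero columns of `c'`.
  have hcc : c * c'.transpose = c' * c'.transpose := by
    ext a b
    simp only [Matrix.mul_apply, Matrix.transpose_apply, hc, hc', hB, dropCols, Matrix.map_apply,
      Matrix.of_apply]
    refine Finset.sum_congr rfl fun γ _ => ?_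
    split_ifs <;> simp
  -- `Y` is chosen so that `c Y` collapses to `-z P c`. Then `(cᵀc - z) Y` involves only `(c -
  -- c')ᵀ`, which lives on the rows `α` and `β`, while these two rows of `Y` agree with the
  -- identity.
  set Y : Matrix (Fin k) (Fin k) ℂ := 1 - c'.transpose * (P * c) with hY
  have hcY : c * Y = -(z • (P * c)) := by
    rw [hY, Matrix.mul_sub, Matrix.mul_one, ← Matrix.mul_assoc, hcc, ← Matrix.mul_assoc, hP1,
      Matrix.add_mul, Matrix.one_mul, Matrix.smul_mul]
    abel
  have hMY : (c.transpose * c - z • (1 : Matrix (Fin k) (Fin k) ℂ)) * Y =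
      -(z • (1 + (c - c').transpose * (P * c))) := by
    rw [Matrix.sub_mul, Matrix.mul_assoc, hcY, Matrix.smul_mul, Matrix.one_mul, hY,
      Matrix.transpose_sub, Matrix.sub_mul, Matrix.mul_neg, Matrix.mul_smul]
    simp only [smul_sub, smul_add]
    abel
  have hfin : Y = -(z • (R + R * ((c - c').transpose * (P * c)))) := by
    have := congrArg (R * ·) hMY
    simp only [← Matrix.mul_assoc] at this
    rw [hR1, Matrix.one_mul] at this
    rw [this, Matrix.mul_neg, Matrix.mul_smul, Matrix.mul_add, Matrix.mul_one]
    simp only [Matrix.mul_assoc]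
  have hYl : Y l i = (1 : Matrix (Fin k) (Fin k) ℂ) l i := by
    have h0 : (c'.transpose * (P * c)) l i = 0 := by
      rw [Matrix.mul_apply]
      refine Finset.sum_eq_zero fun a _ => ?_
      simp [hc', hB, dropCols, hl]
    rw [hY, Matrix.sub_apply, h0, sub_zero]
  have hsum : (R * ((c - c').transpose * (P * c))) l i =
      R l α * colForm A z α β α i + R l β * colForm A z α β β i := by
    have hrow : ∀ γ, ((c - c').transpose * (P * c)) γ i =
        if γ = α ∨ γ = β then colForm A z α β γ i else 0 := by
      intro γ
      rw [Matrix.mul_apply]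
      split_ifs with hγ
      · rw [colForm, Matrix.mul_apply]
        refine Finset.sum_congr rfl fun a _ => ?_
        simp [hc, hc', hB, dropCols, hγ, hP]
      · refine Finset.sum_eq_zero fun a _ => ?_
        simp [hc, hc', hB, dropCols, hγ]
    rw [Matrix.mul_apply]
    simp only [hrow, mul_ite, mul_zero]
    rw [← Finset.sum_filter]
    have : Finset.univ.filter (fun γ => γ = α ∨ γ = β) = {α, β} := by ext γ; simp
    rw [this, Finset.sum_pair hαβ]
  rw [← hYl, hfin, Matrix.neg_apply, Matrix.smul_apply, Matrix.add_apply, hsum, smul_eq_mul]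
  ring

theorem norm_resolvent_det_le {M : Matrix (Fin m) (Fin m) ℝ} (hM : M.IsSymm) {z : ℂ}
    (hz : 0 < z.im) (α β : Fin m) :
    ‖resolvent M z α α * resolvent M z β β - resolvent M z α β * resolvent M z β α‖ ≤
      2 * z.im⁻¹ ^ 2 := by
  have h := norm_resolvent_apply_le hM hz
  have hi : 0 ≤ z.im⁻¹ := by positivity
  refine (norm_sub_le _ _).trans ?_
  rw [norm_mul, norm_mul]
  nlinarith [mul_le_mul (h α α) (h β β) (norm_nonneg _) hi,
    mul_le_mul (h α β) (h β α) (norm_nonneg _) hi]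

/-- The 2 × 2 inverse formula is used in the form `R_αβ = det · z · Q_αβ`; the determinant of the
resolvent block needs only an upper bound. -/
theorem norm_resolvent_offDiag_le (A : Matrix (Fin m) (Fin k) ℝ) {z : ℂ} (hz : 0 < z.im)
    {α β : Fin k} (hαβ : α ≠ β) :
    ‖resolvent (A.transpose * A) z α β‖ ≤ 2 * z.im⁻¹ ^ 2 * ‖z‖ * ‖colForm A z α β α β‖ := by
  have e2 := resolvent_block_eq A hz hαβ (Or.inl rfl) β
  have e4 := resolvent_block_eq A hz hαβ (Or.inr rfl) β
  rw [Matrix.one_apply_ne hαβ] at e2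
  rw [Matrix.one_apply_eq] at e4
  have hsA : (A.transpose * A).IsSymm := by simp [Matrix.IsSymm, Matrix.transpose_mul]
  have hd := norm_resolvent_det_le hsA hz α β
  set R := resolvent (A.transpose * A) z
  set Q := colForm A z α β
  have key : R α β = (R α α * R β β - R α β * R β α) * z * Q α β := by
    linear_combination R α β * e4 - R β β * e2
  rw [key, norm_mul, norm_mul]
  gcongr

theorem norm_resolvent_diag_sub_le (A : Matrix (Fin m) (Fin k) ℝ) {z : ℂ} (hz : 0 < z.im)
    {α β : Fin k} (hαβ : α ≠ β) :
    ‖resolvent (A.transpose * A) z α α - resolvent (A.transpose * A) z β β‖ ≤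
      2 * z.im⁻¹ ^ 2 * ‖z‖ * ‖colForm A z α β α α - colForm A z α β β β‖ := by
  have e1 := resolvent_block_eq A hz hαβ (Or.inl rfl) α
  have e2 := resolvent_block_eq A hz hαβ (Or.inl rfl) β
  have e3 := resolvent_block_eq A hz hαβ (Or.inr rfl) α
  have e4 := resolvent_block_eq A hz hαβ (Or.inr rfl) β
  rw [Matrix.one_apply_ne hαβ] at e2
  rw [Matrix.one_apply_ne hαβ.symm] at e3
  rw [Matrix.one_apply_eq] at e1 e4
  have hsA : (A.transpose * A).IsSymm := by simp [Matrix.IsSymm, Matrix.transpose_mul]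
  have hd := norm_resolvent_det_le hsA hz α β
  set R := resolvent (A.transpose * A) z
  set Q := colForm A z α β
  -- The diagonal entries of the inverse block are `-z (1 + Q_αα)` and `-z (1 + Q_ββ)`, so the ones
  -- cancel in the difference.
  have key : R α α - R β β = (R α α * R β β - R α β * R β α) * z * (Q α α - Q β β) := by
    linear_combination R α α * e4 - R β α * e2 - R β β * e1 + R α β * e3
  rw [key, norm_mul, norm_mul]
  gcongr

theorem colForm_apply (A : Matrix (Fin m) (Fin k) ℝ) (z : ℂ) (α β i j : Fin k) :
    colForm A z α β i j =
      (((fun a => A a i) ⬝ᵥ (resolventRe (dropCols A α β * (dropCols A α β).transpose) z).mulVec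
        (fun a => A a j) : ℝ) : ℂ) +
      (((fun a => A a i) ⬝ᵥ (resolventIm (dropCols A α β * (dropCols A α β).transpose) z).mulVec
        (fun a => A a j) : ℝ) : ℂ) * Complex.I := by
  have h : colForm A z α β i j = ∑ a, (A a i : ℂ) *
      (resolvent (dropCols A α β * (dropCols A α β).transpose) z).mulVec
        (fun b => (A b j : ℂ)) a := by
    rw [colForm, Matrix.mul_apply]
    refine Finset.sum_congr rfl fun a _ => ?_
    simp [Matrix.mul_apply, Matrix.mulVec, dotProduct]
  rw [h]
  simp only [resolvent_mulVec_ofReal]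
  simp only [dotProduct]
  push_cast
  rw [Finset.sum_mul, ← Finset.sum_add_distrib]
  exact Finset.sum_congr rfl fun a _ => by ring

end Resolvent

/-! ### Continuity of resolvent entries, for measurability -/

section Continuity
variable {T : Type*} [TopologicalSpace T] {m : ℕ}

theorem continuous_resolvent_apply {H : T → Matrix (Fin m) (Fin m) ℝ} (hH : Continuous H)
    (hs : ∀ t, (H t).IsSymm) {z : ℂ} (hz : 0 < z.im) (i j : Fin m) :
    Continuous fun t => resolvent (H t) z i j := by
  have hc : Continuous fun t => shifted (H t) z := by
    refine continuous_pi fun i => continuous_pi fun j => ?_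
    have : Continuous fun t => H t i j := (continuous_apply_apply i j).comp hH
    simp only [shifted, Matrix.sub_apply, Matrix.map_apply]
    fun_prop
  have he : ∀ t, resolvent (H t) z i j = (shifted (H t) z).det⁻¹ * (shifted (H t) z).adjugate i j := by
    intro t
    have : resolvent (H t) z = (shifted (H t) z)⁻¹ := rfl
    rw [this, Matrix.inv_def, Matrix.smul_apply, Ring.inverse_eq_inv', smul_eq_mul]
  simp only [he]
  refine Continuous.mul (Continuous.inv₀ hc.matrix_det fun t => ?_) ?_
  · exact (isUnit_det_shifted (hs t) hz).ne_zero
  · exact (continuous_apply_apply i j).comp hc.matrix_adjugate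
theorem continuous_dropCols {n d : ℕ} {A : T → Matrix (Fin n) (Fin d) ℝ} (hA : Continuous A)
    (α β : Fin d) : Continuous fun t => dropCols (A t) α β := by
  refine continuous_pi fun a => continuous_pi fun γ => ?_
  have : Continuous fun t => A t a γ := (continuous_apply_apply a γ).comp hA
  simp only [dropCols, Matrix.of_apply]
  split_ifs <;> fun_prop

end Continuity

/-! ### Resampling of one or two coordinates of a product measure -/

section Update
variable {ι : Type*} [Fintype ι] [DecidableEq ι] {E : Type*} [MeasurableSpace E]

theorem measurePreserving_update (γ : Measure E) [IsProbabilityMeasure γ] (α : ι) :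
    MeasurePreserving (fun q : (ι → E) × E => Function.update q.1 α q.2)
      ((Measure.pi fun _ : ι => γ).prod γ) (Measure.pi fun _ : ι => γ) := by
  have hm : Measurable (fun q : (ι → E) × E => Function.update q.1 α q.2) := by
    refine measurable_pi_iff.2 fun i => ?_
    rcases eq_or_ne i α with rfl | h
    · simpa using measurable_snd
    · simp only [Function.update_of_ne h]
      fun_prop
  refine ⟨hm, (Measure.pi_eq fun s hs => ?_).symm⟩
  rw [Measure.map_apply hm (MeasurableSet.univ_pi hs)]
  have hpre : (fun q : (ι → E) × E => Function.update q.1 α q.2) ⁻¹' Set.univ.pi s =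
      Set.univ.pi (Function.update s α Set.univ) ×ˢ s α := by
    ext ⟨w, u⟩
    simp only [Set.mem_preimage, Set.mem_univ_pi, Set.mem_prod]
    constructor
    · intro h
      refine ⟨fun i => ?_, by simpa using h α⟩
      rcases eq_or_ne i α with rfl | hi
      · simp
      · simpa [hi] using h i
    · rintro ⟨h, hu⟩ i
      rcases eq_or_ne i α with rfl | hi
      · simpa using hu
      · simpa [hi] using h i
  rw [hpre, Measure.prod_prod, Measure.pi_pi, ← Finset.mul_prod_erase _ _ (Finset.mem_univ α),
    ← Finset.mul_prod_erase Finset.univ (fun i => γ (s i)) (Finset.mem_univ α)]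
  rw [Function.update_self, measure_univ, one_mul, mul_comm]
  congr 1
  refine Finset.prod_congr rfl fun i hi => ?_
  rw [Function.update_of_ne (Finset.ne_of_mem_erase hi)]

theorem lintegral_pi_eq_update (γ : Measure E) [IsProbabilityMeasure γ] (α : ι)
    {F : (ι → E) → ℝ≥0∞} (hF : Measurable F) :
    ∫⁻ w, F w ∂(Measure.pi fun _ : ι => γ) =
      ∫⁻ w, ∫⁻ u, F (Function.update w α u) ∂γ ∂(Measure.pi fun _ : ι => γ) := by
  have h := measurePreserving_update γ α
  have hF2 : Measurable fun q : (ι → E) × E => F (Function.update q.1 α q.2) :=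
    hF.comp h.measurable
  rw [← h.lintegral_comp hF, lintegral_prod _ hF2.aemeasurable]

/-- Resampling preserves the product law, so a bound on the integral over two fresh coordinates,
uniform in the others, bounds the whole integral. It plays the role of conditioning on the other
columns. -/
theorem lintegral_pi_le_of_update (γ : Measure E) [IsProbabilityMeasure γ] (α β : ι)
    {F : (ι → E) → ℝ≥0∞} (hF : Measurable F) {c : ℝ≥0∞}
    (hc : ∀ w, ∫⁻ v, ∫⁻ u, F (Function.update (Function.update w β v) α u) ∂γ ∂γ ≤ c) :
    ∫⁻ w, F w ∂(Measure.pi fun _ : ι => γ) ≤ c := by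
  have h := measurePreserving_update γ α
  have hF2 : Measurable fun q : (ι → E) × E => F (Function.update q.1 α q.2) :=
    hF.comp h.measurable
  rw [lintegral_pi_eq_update γ α hF, lintegral_pi_eq_update γ β hF2.lintegral_prod_right']
  calc _ ≤ ∫⁻ _w, c ∂(Measure.pi fun _ : ι => γ) := lintegral_mono hc
    _ = c := by simp
end Update

theorem measure_gt_le_of_moment {Ω : Type*} [MeasurableSpace Ω] (μ : Measure Ω) {Q : Ω → ℝ}
    (hQ : Measurable Q) {t : ℝ} (ht : 0 < t) {c : ℝ≥0∞} (p : ℕ)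
    (hc : ∫⁻ ω, ‖Q ω‖ₑ ^ p ∂μ ≤ c) : μ {ω | t < |Q ω|} ≤ c / ENNReal.ofReal (t ^ p) := by
  have h0 : ENNReal.ofReal (t ^ p) ≠ 0 := by
    rw [Ne, ENNReal.ofReal_eq_zero, not_le]; positivity
  refine le_trans (measure_mono ?_) ((meas_ge_le_lintegral_div (f := fun ω => ‖Q ω‖ₑ ^ p)
    (by fun_prop) h0 ENNReal.ofReal_ne_top).trans (ENNReal.div_le_div_right hc _))
  intro ω hω
  change ENNReal.ofReal (t ^ p) ≤ ‖Q ω‖ₑ ^ p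
  rw [← ofReal_norm, ← ENNReal.ofReal_pow (norm_nonneg _)]
  exact ENNReal.ofReal_le_ofReal (pow_le_pow_left₀ ht.le (le_of_lt hω) _)

/-! ### Tail bounds for the column forms with the data fixed -/

section Columns
variable {E : Type*} [NormedAddCommGroup E] [InnerProductSpace ℝ E] {N M : ℕ}

/-- The matrix whose columns are the feature vectors of the `w α`. -/
noncomputable def featMat (σ : ℝ → ℝ) (ξ : Fin N → E) (s : ℝ) (w : Fin M → E) :
    Matrix (Fin N) (Fin M) ℝ := Matrix.of fun a α => feat σ ξ s (w α) a

/-- This is the independence of the reduced resolvent from the two removed columns. -/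
theorem dropCols_featMat_update (σ : ℝ → ℝ) (ξ : Fin N → E) (s : ℝ) (w : Fin M → E)
    (α β : Fin M) (u v : E) :
    dropCols (featMat σ ξ s (Function.update (Function.update w β v) α u)) α β =
      dropCols (featMat σ ξ s w) α β := by
  ext a γ
  simp only [dropCols, featMat, Matrix.of_apply]
  split_ifs with h
  · rfl
  · push Not at h
    rw [Function.update_of_ne h.1, Function.update_of_ne h.2]

theorem continuous_dropCols_featMat {σ : ℝ → ℝ} (hσ : Continuous σ) (ξ : Fin N → E) (s : ℝ)
    (α β : Fin M) : Continuous fun w : Fin M → E =>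
      dropCols (featMat σ ξ s w) α β * (dropCols (featMat σ ξ s w) α β).transpose := by
  have hA : Continuous fun w : Fin M → E => featMat σ ξ s w :=
    continuous_pi fun a => continuous_pi fun γ => by
      simp only [featMat, Matrix.of_apply, feat]
      fun_prop
  have h := continuous_dropCols hA α β
  exact h.matrix_mul h.matrix_transpose

theorem isSymm_mul_transpose_self {m k : ℕ} (A : Matrix (Fin m) (Fin k) ℝ) :
    (A * A.transpose).IsSymm := by simp [Matrix.IsSymm, Matrix.transpose_mul]

variable [FiniteDimensional ℝ E] [MeasurableSpace E] [BorelSpace E]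

theorem measurable_feat_form {σ : ℝ → ℝ} (hσ : Continuous σ) (ξ : Fin N → E) (s : ℝ)
    {G : (Fin M → E) → Matrix (Fin N) (Fin N) ℝ} (hG : ∀ i j, Measurable fun w => G w i j)
    (α β : Fin M) :
    Measurable fun w : Fin M → E => feat σ ξ s (w α) ⬝ᵥ (G w).mulVec (feat σ ξ s (w β)) := by
  have hf : ∀ (α : Fin M) i, Measurable fun w : Fin M → E => feat σ ξ s (w α) i := by
    intro α i
    have : Continuous fun w : Fin M → E => feat σ ξ s (w α) i := by unfold feat; fun_prop
    exact this.measurable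
  simp only [dotProduct, Matrix.mulVec]
  exact Finset.measurable_sum _ fun i _ => (hf α i).mul
    (Finset.measurable_sum _ fun j _ => (hG i j).mul (hf β j))

theorem measurable_resolventRe {σ : ℝ → ℝ} (hσ : Continuous σ) (ξ : Fin N → E) (s : ℝ)
    {z : ℂ} (hz : 0 < z.im) (α β : Fin M) (i j : Fin N) :
    Measurable fun w : Fin M → E => resolventRe
      (dropCols (featMat σ ξ s w) α β * (dropCols (featMat σ ξ s w) α β).transpose) z i j :=
  (Complex.continuous_re.comp (continuous_resolvent_apply
    (continuous_dropCols_featMat hσ ξ s α β) (fun _ => isSymm_mul_transpose_self _) hz i j)).measurable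

theorem measurable_resolventIm {σ : ℝ → ℝ} (hσ : Continuous σ) (ξ : Fin N → E) (s : ℝ)
    {z : ℂ} (hz : 0 < z.im) (α β : Fin M) (i j : Fin N) :
    Measurable fun w : Fin M → E => resolventIm
      (dropCols (featMat σ ξ s w) α β * (dropCols (featMat σ ξ s w) α β).transpose) z i j :=
  (Complex.continuous_im.comp (continuous_resolvent_apply
    (continuous_dropCols_featMat hσ ξ s α β) (fun _ => isSymm_mul_transpose_self _) hz i j)).measurable

/-- Constant in the tail bound for the column forms. -/
noncomputable def formConst (p : ℕ) (L b κ : ℝ) : ℝ≥0∞ :=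
  bilinConst p L b κ + incrConst p L (2 * b) * ENNReal.ofReal ((2 * L * √κ * b ^ 2) ^ p)

theorem formConst_lt_top (p : ℕ) (L b κ : ℝ) : formConst p L b κ < ⊤ :=
  ENNReal.add_lt_top.2 ⟨bilinConst_lt_top _ _ _ _,
    ENNReal.mul_lt_top (incrConst_lt_top _ _ _) ENNReal.ofReal_lt_top⟩

variable [NeZero N]

/-- Tail bounds for the off-diagonal and diagonal forms of one symmetric matrix which does not
depend on the two columns. -/
theorem measure_form_gt_le {σ ψ : ℝ → ℝ} {b L s κ τ β' t : ℝ}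
    (h : ExpDeriv σ ψ b) (hσ : ∫ x, σ x ∂(gaussianReal 0 1) = 0) (hs : 0 < s)
    (hκ : (N : ℝ) ≤ κ * s ^ 2)
    {ξ : Fin N → E} (hξ : SynthesisBound ξ L) (hL : 0 ≤ L) (hτ : 1 / s ≤ τ)
    (hnorm : ∀ i, |‖ξ i‖ ^ 2 - 1| ≤ τ) (hβ : 0 ≤ β') (ht : 0 < t)
    {G : (Fin M → E) → Matrix (Fin N) (Fin N) ℝ} (hG : ∀ i j, Measurable fun w => G w i j)
    (hsymm : ∀ w, (G w).IsSymm) (hbd : ∀ w a, l2 ((G w).mulVec a) ≤ β' * l2 a)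
    {α β : Fin M} (hαβ : α ≠ β)
    (hup : ∀ w u v, G (Function.update (Function.update w β v) α u) = G w) (p : ℕ) :
    (Measure.pi fun _ : Fin M => stdGaussian E)
      ({w | t < |feat σ ξ s (w α) ⬝ᵥ (G w).mulVec (feat σ ξ s (w β))|} ∪
       {w | t < |feat σ ξ s (w α) ⬝ᵥ (G w).mulVec (feat σ ξ s (w α)) -
          feat σ ξ s (w β) ⬝ᵥ (G w).mulVec (feat σ ξ s (w β))|}) ≤
      formConst (p + 1) L b κ * N ^ 2 * ENNReal.ofReal ((β' * τ) ^ (p + 1)) /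
        ENNReal.ofReal (t ^ (p + 1)) := by
  have hb := h.pos
  have hτ0 : 0 < τ := lt_of_lt_of_le (by positivity) hτ
  have hκ' : (Fintype.card (Fin N) : ℝ) ≤ κ * s ^ 2 := by simpa using hκ
  have hN : (1 : ℝ≥0∞) ≤ N := by exact_mod_cast NeZero.one_le
  have hmo : Measurable fun w : Fin M → E =>
      feat σ ξ s (w α) ⬝ᵥ (G w).mulVec (feat σ ξ s (w β)) :=
    measurable_feat_form h.continuous ξ s hG α β
  have hmd : Measurable fun w : Fin M → E =>
      feat σ ξ s (w α) ⬝ᵥ (G w).mulVec (feat σ ξ s (w α)) -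
          feat σ ξ s (w β) ⬝ᵥ (G w).mulVec (feat σ ξ s (w β)) :=
    (measurable_feat_form h.continuous ξ s hG α α).sub
      (measurable_feat_form h.continuous ξ s hG β β)
  have hup1 : ∀ (w : Fin M → E) u v, Function.update (Function.update w β v) α u α = u := by simp
  have hup2 : ∀ (w : Fin M → E) u v, Function.update (Function.update w β v) α u β = v := by
    intro w u v; rw [Function.update_of_ne hαβ.symm]; simp
  have ho := measure_gt_le_of_moment (Measure.pi fun _ : Fin M => stdGaussian E) hmo ht (p + 1)
    (lintegral_pi_le_of_update (stdGaussian E) α β (hmo.enorm.pow_const _) (fun w => by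
      simp only [hup1, hup2, hup]
      exact lintegral_bilinear_pow_le h hσ hs hκ' hξ hL hτ hnorm hβ (hbd w) p))
  have hd := measure_gt_le_of_moment (Measure.pi fun _ : Fin M => stdGaussian E) hmd ht (p + 1)
    (lintegral_pi_le_of_update (stdGaussian E) α β (hmd.enorm.pow_const _) (fun w => by
      simp only [hup1, hup2, hup]
      exact lintegral_quadratic_sub_pow_le h hs hκ' hξ hL (hsymm w) hβ (hbd w) p))
  refine (measure_union_le _ _).trans ((add_le_add ho hd).trans ?_)
  rw [ENNReal.div_add_div_same, Fintype.card_fin]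
  refine ENNReal.div_le_div_right ?_ _
  rw [formConst, add_mul, add_mul]
  refine add_le_add le_rfl ?_
  calc _ ≤ incrConst (p + 1) L (2 * b) * N * (ENNReal.ofReal ((2 * L * √κ * b ^ 2) ^ (p + 1)) *
        ENNReal.ofReal ((β' * τ) ^ (p + 1))) := by
        rw [← ENNReal.ofReal_mul (by positivity), ← mul_pow]
        refine mul_le_mul_right (ENNReal.ofReal_le_ofReal
          (pow_le_pow_left₀ (by positivity) ?_ _)) _
        calc 2 * L * √κ * b ^ 2 * β' / s = 2 * L * √κ * b ^ 2 * (β' * (1 / s)) := by ring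
          _ ≤ _ := by gcongr
    _ ≤ incrConst (p + 1) L (2 * b) * N ^ 2 * (ENNReal.ofReal ((2 * L * √κ * b ^ 2) ^ (p + 1)) *
        ENNReal.ofReal ((β' * τ) ^ (p + 1))) := by
        -- The quadratic form costs one factor `N`, the bilinear form two; the larger power is used
        -- for both.
        gcongr
        exact le_self_pow hN two_ne_zero
    _ = _ := by ring

/-- The event that some column form is large. -/
def largeForms (σ : ℝ → ℝ) (ξ : Fin N → E) (s : ℝ) (z : ℂ) (t : ℝ) : Set (Fin M → E) :=
  {w | ∃ α β, α ≠ β ∧ (2 * t < ‖colForm (featMat σ ξ s w) z α β α β‖ ∨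
    2 * t < ‖colForm (featMat σ ξ s w) z α β α α - colForm (featMat σ ξ s w) z α β β β‖)}

theorem measure_largeForms_le {σ ψ : ℝ → ℝ} {b L s κ τ t : ℝ}
    (h : ExpDeriv σ ψ b) (hσ : ∫ x, σ x ∂(gaussianReal 0 1) = 0) (hs : 0 < s)
    (hκ : (N : ℝ) ≤ κ * s ^ 2)
    {ξ : Fin N → E} (hξ : SynthesisBound ξ L) (hL : 0 ≤ L) (hτ : 1 / s ≤ τ)
    (hnorm : ∀ i, |‖ξ i‖ ^ 2 - 1| ≤ τ) (ht : 0 < t) {z : ℂ} (hz : 0 < z.im) (p : ℕ) :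
    (Measure.pi fun _ : Fin M => stdGaussian E) (largeForms σ ξ s z t) ≤
      M ^ 2 * (2 * (formConst (p + 1) L b κ * N ^ 2 *
        ENNReal.ofReal ((z.im⁻¹ * τ) ^ (p + 1)) / ENNReal.ofReal (t ^ (p + 1)))) := by
  set ϖ := Measure.pi fun _ : Fin M => stdGaussian E
  set c := formConst (p + 1) L b κ * N ^ 2 *
        ENNReal.ofReal ((z.im⁻¹ * τ) ^ (p + 1)) / ENNReal.ofReal (t ^ (p + 1))
  let Z : (Fin M → E) → Fin M → Fin M → Matrix (Fin N) (Fin N) ℝ := fun w α β =>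
    dropCols (featMat σ ξ s w) α β * (dropCols (featMat σ ξ s w) α β).transpose
  let bad : (Matrix (Fin N) (Fin N) ℝ → Matrix (Fin N) (Fin N) ℝ) → Fin M → Fin M →
    Set (Fin M → E) := fun g α β =>
      ({w | t < |feat σ ξ s (w α) ⬝ᵥ (g (Z w α β)).mulVec (feat σ ξ s (w β))|} ∪
       {w | t < |feat σ ξ s (w α) ⬝ᵥ (g (Z w α β)).mulVec (feat σ ξ s (w α)) -
          feat σ ξ s (w β) ⬝ᵥ (g (Z w α β)).mulVec (feat σ ξ s (w β))|})
  have hZ : ∀ w α β, (Z w α β).IsSymm := fun w α β => isSymm_mul_transpose_self _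
  have hre : ∀ α β, α ≠ β → ϖ (bad (fun H => resolventRe H z) α β) ≤ c := fun α β hαβ =>
    measure_form_gt_le h hσ hs hκ hξ hL hτ hnorm (by positivity) ht
      (measurable_resolventRe h.continuous ξ s hz α β) (fun w => resolventRe_isSymm (hZ w α β) z)
      (fun w a => (l2_resolvent_parts_le (hZ w α β) hz a).1) hαβ
      (fun w u v => by rw [dropCols_featMat_update]) p
  have him : ∀ α β, α ≠ β → ϖ (bad (fun H => resolventIm H z) α β) ≤ c := fun α β hαβ =>
    measure_form_gt_le h hσ hs hκ hξ hL hτ hnorm (by positivity) ht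
      (measurable_resolventIm h.continuous ξ s hz α β) (fun w => resolventIm_isSymm (hZ w α β) z)
      (fun w a => (l2_resolvent_parts_le (hZ w α β) hz a).2) hαβ
      (fun w u v => by rw [dropCols_featMat_update]) p
  have hsub : largeForms σ ξ s z t ⊆ ⋃ q : Fin M × Fin M, {w | q.1 ≠ q.2 ∧
      w ∈ bad (fun H => resolventRe H z) q.1 q.2 ∪ bad (fun H => resolventIm H z) q.1 q.2} := by
    rintro w ⟨α, β, hαβ, hw⟩
    refine Set.mem_iUnion.2 ⟨(α, β), hαβ, ?_⟩
    -- The threshold `2 * t` allows `t` for each of the real and imaginary parts.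
    have hle : ∀ x y : ℝ, 2 * t < ‖(x : ℂ) + (y : ℂ) * Complex.I‖ → t < |x| ∨ t < |y| := by
      intro x y hxy
      by_contra hc
      push Not at hc
      have := norm_add_le (x : ℂ) ((y : ℂ) * Complex.I)
      rw [norm_mul, Complex.norm_I, mul_one, Complex.norm_real, Complex.norm_real,
        Real.norm_eq_abs, Real.norm_eq_abs] at this
      linarith
    rcases hw with hw | hw
    · rw [colForm_apply] at hw
      rcases hle _ _ hw with h1 | h1
      · exact Or.inl (Or.inl h1)
      · exact Or.inr (Or.inl h1)
    · rw [colForm_apply, colForm_apply, add_sub_add_comm, ← sub_mul, ← Complex.ofReal_sub,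
        ← Complex.ofReal_sub] at hw
      rcases hle _ _ hw with h1 | h1
      · exact Or.inl (Or.inr h1)
      · exact Or.inr (Or.inr h1)
  calc ϖ (largeForms σ ξ s z t) ≤ ∑ q : Fin M × Fin M, ϖ {w | q.1 ≠ q.2 ∧
      w ∈ bad (fun H => resolventRe H z) q.1 q.2 ∪ bad (fun H => resolventIm H z) q.1 q.2} :=
        (measure_mono hsub).trans (measure_iUnion_fintype_le _ _)
    _ ≤ ∑ _q : Fin M × Fin M, 2 * c := by
        refine Finset.sum_le_sum fun q _ => ?_
        by_cases hq : q.1 = q.2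
        · simp [hq]
        · refine (measure_mono fun w hw => hw.2).trans ((measure_union_le _ _).trans ?_)
          rw [two_mul]
          exact add_le_add (hre _ _ hq) (him _ _ hq)
    _ = _ := by simp [sq]
end Columns

/-! ### Operator norm of a Gaussian matrix -/

section OpNorm
variable {N : ℕ} {E : Type*} [NormedAddCommGroup E] [InnerProductSpace ℝ E]

/-- The synthesis operator `c ↦ ∑ i, c i • g i`. -/
noncomputable def synth (g : Fin N → E) : EuclideanSpace ℝ (Fin N) →L[ℝ] E :=
  ∑ i, (EuclideanSpace.proj i : EuclideanSpace ℝ (Fin N) →L[ℝ] ℝ).smulRight (g i)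

theorem synth_apply (g : Fin N → E) (c : EuclideanSpace ℝ (Fin N)) :
    synth g c = ∑ i, c i • g i := by
  simp [synth]

/-- The bilinear form stays large near an almost maximizing pair of unit-size vectors: the losses
are `0.9 - 1/4 - 5/16 > 1/4`. Having a whole ball of such pairs replaces a net by a volume
comparison. -/
theorem le_inner_synth {g : Fin N → E} {T : ℝ} (hT : 0 < T) (hg : T ≤ ‖synth g‖) :
    ∃ h₀ : EuclideanSpace ℝ (Fin N) × E, Metric.ball h₀ (1 / 4) ⊆ Metric.ball 0 2 ∧
      ∀ h ∈ Metric.ball h₀ (1 / 4), T / 4 ≤ ⟪synth g h.1, h.2⟫ := by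
  set f := synth g with hf
  obtain ⟨c, hc, hfc⟩ := f.exists_lt_apply_of_lt_opNorm (r := 9 / 10 * ‖f‖) (by linarith)
  have hpos : 0 < ‖f c‖ := lt_of_le_of_lt (by positivity) hfc
  set v : E := (‖f c‖)⁻¹ • f c with hv
  have hvn : ‖v‖ = 1 := by
    rw [hv, norm_smul, norm_inv, norm_norm, inv_mul_cancel₀ hpos.ne']
  have hfv : ⟪f c, v⟫ = ‖f c‖ := by
    rw [hv, inner_smul_right, real_inner_self_eq_norm_sq]
    field_simp
  refine ⟨(c, v), ?_, ?_⟩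
  · intro h hh
    rw [Metric.mem_ball, dist_zero_right]
    rw [Metric.mem_ball, dist_eq_norm] at hh
    have h1 : ‖((c, v) : EuclideanSpace ℝ (Fin N) × E)‖ ≤ 1 := by
      rw [Prod.norm_def]; exact max_le hc.le hvn.le
    have h2 := norm_sub_norm_le h (c, v)
    linarith
  · rintro ⟨c', v'⟩ hh
    rw [Metric.mem_ball, dist_eq_norm, Prod.norm_def, max_lt_iff] at hh
    obtain ⟨hc', hv'⟩ := hh
    simp only [Prod.fst_sub, Prod.snd_sub] at hc' hv'
    have hexp : ⟪f c', v'⟫ = ⟪f c, v⟫ + ⟪f c, v' - v⟫ + ⟪f (c' - c), v'⟫ := by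
      rw [inner_sub_right, map_sub, inner_sub_left]; ring
    have h1 : |⟪f c, v' - v⟫| ≤ ‖f‖ * (1 / 4) := by
      refine (abs_real_inner_le_norm _ _).trans ?_
      have : ‖f c‖ ≤ ‖f‖ := (f.le_opNorm c).trans (mul_le_of_le_one_right (norm_nonneg _) hc.le)
      exact mul_le_mul this hv'.le (norm_nonneg _) (norm_nonneg _)
    have hv'n : ‖v'‖ ≤ 5 / 4 := by
      have := norm_sub_norm_le v' v; linarith
    have h2 : |⟪f (c' - c), v'⟫| ≤ ‖f‖ * (1 / 4) * (5 / 4) := by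
      refine (abs_real_inner_le_norm _ _).trans ?_
      have : ‖f (c' - c)‖ ≤ ‖f‖ * (1 / 4) :=
        (f.le_opNorm _).trans (mul_le_mul_of_nonneg_left hc'.le (norm_nonneg _))
      exact mul_le_mul this hv'n (norm_nonneg _) (by positivity)
    change T / 4 ≤ ⟪f c', v'⟫
    rw [hexp, hfv]
    have h3 := (abs_le.1 h1).1
    have h4 := (abs_le.1 h2).1
    linarith

variable [FiniteDimensional ℝ E] [MeasurableSpace E] [BorelSpace E]

theorem lintegral_exp_inner_stdGaussian (x : E) (k : ℝ) :
    ∫⁻ w, ENNReal.ofReal (Real.exp (k * ⟪x, w⟫)) ∂(stdGaussian E) =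
      ENNReal.ofReal (Real.exp (‖x‖ ^ 2 * k ^ 2 / 2)) := by
  have h1 : ∫⁻ w, ENNReal.ofReal (Real.exp (k * ⟪x, w⟫)) ∂(stdGaussian E) =
      ∫⁻ t, ENNReal.ofReal (Real.exp (k * t)) ∂(gaussianReal 0 (‖x‖₊ ^ 2)) := by
    rw [← map_inner_stdGaussian, lintegral_map (by fun_prop) (by fun_prop)]
  rw [h1, ← ofReal_integral_eq_lintegral_ofReal (integrable_exp_mul_gaussianReal k)
    (.of_forall fun t => (Real.exp_pos _).le)]
  have := congrFun (mgf_id_gaussianReal (μ := 0) (v := ‖x‖₊ ^ 2)) k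
  simp only [mgf, id_eq, zero_mul, zero_add] at this
  rw [this]
  simp

theorem lintegral_exp_synth (c : EuclideanSpace ℝ (Fin N)) (v : E) (k : ℝ) :
    ∫⁻ g, ENNReal.ofReal (Real.exp (k * ⟪synth g c, v⟫))
      ∂(Measure.pi fun _ : Fin N => stdGaussian E) =
      ENNReal.ofReal (Real.exp (‖c‖ ^ 2 * ‖v‖ ^ 2 * k ^ 2 / 2)) := by
  have h1 : ∀ g : Fin N → E, ENNReal.ofReal (Real.exp (k * ⟪synth g c, v⟫)) =
      ∏ i, ENNReal.ofReal (Real.exp (k * c i * ⟪v, g i⟫)) := by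
    intro g
    rw [← ENNReal.ofReal_prod_of_nonneg fun i _ => (Real.exp_pos _).le, ← Real.exp_sum]
    congr 2
    rw [synth_apply, sum_inner, Finset.mul_sum]
    refine Finset.sum_congr rfl fun i _ => ?_
    rw [real_inner_smul_left, real_inner_comm]; ring
  simp_rw [h1]
  have hind : iIndepFun (fun (i : Fin N) (g : Fin N → E) =>
      ENNReal.ofReal (Real.exp (k * c i * ⟪v, g i⟫))) (Measure.pi fun _ : Fin N => stdGaussian E) :=
    iIndepFun_pi (X := fun i x => ENNReal.ofReal (Real.exp (k * c i * ⟪v, x⟫)))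
      (fun i => by fun_prop)
  rw [lintegral_prod_eq_prod_lintegral_of_indepFun Finset.univ _ hind (fun i => by fun_prop)]
  have h2 : ∀ i, ∫⁻ g : Fin N → E, ENNReal.ofReal (Real.exp (k * c i * ⟪v, g i⟫))
      ∂(Measure.pi fun _ : Fin N => stdGaussian E) =
      ENNReal.ofReal (Real.exp (‖v‖ ^ 2 * (k * c i) ^ 2 / 2)) := by
    intro i
    rw [← lintegral_exp_inner_stdGaussian]
    exact (measurePreserving_eval (fun _ : Fin N => stdGaussian E) i).lintegral_comp
      (f := fun x => ENNReal.ofReal (Real.exp (k * c i * ⟪v, x⟫))) (by fun_prop)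
  simp_rw [h2]
  rw [← ENNReal.ofReal_prod_of_nonneg fun i _ => (Real.exp_pos _).le, ← Real.exp_sum]
  congr 2
  rw [EuclideanSpace.real_norm_sq_eq, Finset.sum_mul, Finset.sum_mul, Finset.sum_div]
  refine Finset.sum_congr rfl fun i _ => by ring

/-- The operator norm of a Gaussian matrix, by comparing the volume of a neighbourhood of the
maximizing directions with that of a ball. -/
theorem measure_le_norm_synth_le {T : ℝ} (hT : 0 < T) :
    (Measure.pi fun _ : Fin N => stdGaussian E) {g | T ≤ ‖synth g‖} ≤
      ENNReal.ofReal (8 ^ (N + Module.finrank ℝ E) * Real.exp (-(T ^ 2 / 512))) := by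
  set ϖ := Measure.pi fun _ : Fin N => stdGaussian E
  set D := N + Module.finrank ℝ E with hD
  -- This choice maximizes `lam * (T / 4) - 8 * lam ^ 2`, with value `T² / 512`.
  set lam : ℝ := T / 64 with hlam
  have hfr : Module.finrank ℝ (EuclideanSpace ℝ (Fin N) × E) = D := by simp [hD]
  obtain ⟨vol, hvol⟩ : ∃ vol : Measure (EuclideanSpace ℝ (Fin N) × E), vol.IsAddHaarMeasure :=
    ⟨(volume : Measure (EuclideanSpace ℝ (Fin N))).prod volume, inferInstance⟩
  set V := vol (Metric.ball 0 1) with hV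
  have hV0 : V ≠ 0 := (Metric.measure_ball_pos _ _ one_pos).ne'
  have hVt : V ≠ ⊤ := measure_ball_lt_top.ne
  let Z : (Fin N → E) → ℝ≥0∞ := fun g =>
    ∫⁻ h in Metric.ball (0 : EuclideanSpace ℝ (Fin N) × E) 2, ENNReal.ofReal (Real.exp (lam * ⟪synth g h.1, h.2⟫)) ∂vol
  have hjm : Measurable fun q : (Fin N → E) × (EuclideanSpace ℝ (Fin N) × E) =>
      ENNReal.ofReal (Real.exp (lam * ⟪synth q.1 q.2.1, q.2.2⟫)) := by
    simp only [synth_apply]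
    fun_prop
  have hZm : Measurable Z := Measurable.lintegral_prod_right' hjm
  have hZint : ∫⁻ g, Z g ∂ϖ ≤ ENNReal.ofReal (Real.exp (8 * lam ^ 2)) *
      (ENNReal.ofReal (2 ^ D) * V) := by
    calc ∫⁻ g, Z g ∂ϖ = ∫⁻ h in Metric.ball (0 : EuclideanSpace ℝ (Fin N) × E) 2, ∫⁻ g, ENNReal.ofReal
          (Real.exp (lam * ⟪synth g h.1, h.2⟫)) ∂ϖ ∂vol :=
          lintegral_lintegral_swap hjm.aemeasurable
      _ ≤ ∫⁻ h in Metric.ball (0 : EuclideanSpace ℝ (Fin N) × E) 2, ENNReal.ofReal (Real.exp (8 * lam ^ 2)) ∂vol := by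
          refine setLIntegral_mono' measurableSet_ball fun h hh => ?_
          rw [lintegral_exp_synth]
          refine ENNReal.ofReal_le_ofReal (Real.exp_le_exp.2 ?_)
          rw [Metric.mem_ball, dist_zero_right, Prod.norm_def, max_lt_iff] at hh
          have h1 : ‖h.1‖ ^ 2 ≤ 4 := by nlinarith [norm_nonneg h.1]
          have h2 : ‖h.2‖ ^ 2 ≤ 4 := by nlinarith [norm_nonneg h.2]
          have h3 : ‖h.1‖ ^ 2 * ‖h.2‖ ^ 2 ≤ 4 * 4 := by gcongr
          nlinarith [sq_nonneg lam]
      _ = _ := by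
          rw [setLIntegral_const, Measure.addHaar_ball_of_pos vol _ two_pos, hfr]
  set c : ℝ≥0∞ := ENNReal.ofReal (Real.exp (lam * (T / 4))) * (ENNReal.ofReal ((1 / 4) ^ D) * V)
    with hc
  -- A large norm makes the exponential large on a ball of radius `1/4`, hence makes `Z` large. The
  -- ratio of this volume to that of the ball of radius `2` gives `8 ^ D`.
  have hsub : {g : Fin N → E | T ≤ ‖synth g‖} ⊆ {g | c ≤ Z g} := by
    intro g hg
    obtain ⟨h₀, hb, hle⟩ := le_inner_synth hT hg
    change c ≤ Z g
    calc c = ∫⁻ h in Metric.ball h₀ (1 / 4), ENNReal.ofReal (Real.exp (lam * (T / 4))) ∂vol := by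
          rw [setLIntegral_const, Measure.addHaar_ball_of_pos vol _ (by norm_num), hfr]
      _ ≤ ∫⁻ h in Metric.ball h₀ (1 / 4), ENNReal.ofReal
          (Real.exp (lam * ⟪synth g h.1, h.2⟫)) ∂vol := by
          refine setLIntegral_mono' measurableSet_ball fun h hh => ?_
          refine ENNReal.ofReal_le_ofReal (Real.exp_le_exp.2 ?_)
          exact mul_le_mul_of_nonneg_left (hle h hh) (by positivity)
      _ ≤ Z g := lintegral_mono_set hb
  have hc0 : c ≠ 0 := by
    rw [hc]
    refine mul_ne_zero ?_ (mul_ne_zero ?_ hV0)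
    · rw [Ne, ENNReal.ofReal_eq_zero, not_le]; positivity
    · rw [Ne, ENNReal.ofReal_eq_zero, not_le]; positivity
  have hct : c ≠ ⊤ :=
    ENNReal.mul_ne_top ENNReal.ofReal_ne_top (ENNReal.mul_ne_top ENNReal.ofReal_ne_top hVt)
  refine (measure_mono hsub).trans ((meas_ge_le_lintegral_div hZm.aemeasurable hc0 hct).trans ?_)
  refine ENNReal.div_le_of_le_mul (hZint.trans (le_of_eq ?_))
  rw [hc, ← mul_assoc, ← mul_assoc, ← mul_assoc, ← ENNReal.ofReal_mul (by positivity),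
    ← ENNReal.ofReal_mul (by positivity), ← ENNReal.ofReal_mul (by positivity)]
  congr 2
  have e1 : Real.exp (8 * lam ^ 2) = Real.exp (-(T ^ 2 / 512)) * Real.exp (lam * (T / 4)) := by
    rw [← Real.exp_add, hlam]; ring_nf
  have e2 : (2 : ℝ) ^ D = 8 ^ D * (1 / 4) ^ D := by rw [← mul_pow]; norm_num
  rw [e1, e2]; ring

theorem measure_norm_synth_tail :
    (Measure.pi fun _ : Fin N => stdGaussian E)
      {g | √(2048 * (N + Module.finrank ℝ E + 1)) ≤ ‖synth g‖} ≤
      ENNReal.ofReal (Real.exp (-N)) := by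
  refine (measure_le_norm_synth_le (by positivity)).trans (ENNReal.ofReal_le_ofReal ?_)
  -- The exponent becomes `-4 (D + 1)` with `D` the total dimension, which beats `8 ^ D ≤ e^{3 D}`.
  rw [Real.sq_sqrt (by positivity)]
  have h8 : (8 : ℝ) ≤ Real.exp 3 := by
    have h2 : (2 : ℝ) ≤ Real.exp 1 := by linarith [Real.add_one_le_exp (1 : ℝ)]
    calc (8 : ℝ) = 2 ^ 3 := by norm_num
      _ ≤ Real.exp 1 ^ 3 := by gcongr
      _ = Real.exp 3 := by rw [← Real.exp_nat_mul]; norm_num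
  calc (8 : ℝ) ^ (N + Module.finrank ℝ E) *
        Real.exp (-(2048 * (N + Module.finrank ℝ E + 1) / 512))
      ≤ Real.exp 3 ^ (N + Module.finrank ℝ E) *
        Real.exp (-(2048 * (N + Module.finrank ℝ E + 1) / 512)) := by gcongr
    _ = Real.exp (-(N + Module.finrank ℝ E + 4)) := by
        rw [← Real.exp_nat_mul, ← Real.exp_add]; push_cast; ring_nf
    _ ≤ Real.exp (-N) := by
        refine Real.exp_le_exp.2 ?_
        have : (0 : ℝ) ≤ Module.finrank ℝ E := by positivity
        linarith
end OpNorm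

/-! ### Regularity of the data -/

section Covariance
variable {m : ℕ} {S : Matrix (Fin m) (Fin m) ℝ} {B : ℝ}

/-- The square root of the covariance as an operator. -/
noncomputable def covRoot (S : Matrix (Fin m) (Fin m) ℝ) :
    EuclideanSpace ℝ (Fin m) →L[ℝ] EuclideanSpace ℝ (Fin m) :=
  Matrix.toEuclideanCLM (𝕜 := ℝ) (CFC.sqrt S)

theorem isSelfAdjoint_covRoot (S : Matrix (Fin m) (Fin m) ℝ) : IsSelfAdjoint (covRoot S) :=
  (CFC.sqrt_nonneg S).isSelfAdjoint.map _

theorem inner_covRoot_comm (S : Matrix (Fin m) (Fin m) ℝ) (x y : EuclideanSpace ℝ (Fin m)) :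
    ⟪covRoot S x, y⟫ = ⟪covRoot S y, x⟫ := by
  rw [← ContinuousLinearMap.adjoint_inner_right, (isSelfAdjoint_covRoot S).adjoint_eq,
    real_inner_comm]

theorem covRoot_covRoot (hS : S.PosSemidef) (x : EuclideanSpace ℝ (Fin m)) :
    covRoot S (covRoot S x) = Matrix.toEuclideanCLM (𝕜 := ℝ) S x := by
  rw [covRoot, ← ContinuousLinearMap.comp_apply, ← ContinuousLinearMap.mul_def, ← map_mul,
      CFC.sqrt_mul_sqrt_self _ hS.nonneg]

theorem norm_covRoot_sq (hS : S.PosSemidef) (x : EuclideanSpace ℝ (Fin m)) :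
    ‖covRoot S x‖ ^ 2 = x.ofLp ⬝ᵥ S.mulVec x.ofLp := by
  rw [← real_inner_self_eq_norm_sq, inner_covRoot_comm, covRoot_covRoot hS, real_inner_comm,
    Matrix.inner_toEuclideanCLM]

theorem norm_covRoot_le (h : IsDataCovariance S B) (x : EuclideanSpace ℝ (Fin m)) :
    ‖covRoot S x‖ ≤ √B * ‖x‖ := by
  have hB : 0 ≤ B := (norm_nonneg _).trans h.norm_le
  refine abs_le_of_sq_le_sq' ?_ (by positivity) |>.2
  rw [mul_pow, Real.sq_sqrt hB, ← real_inner_self_eq_norm_sq, inner_covRoot_comm,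
    covRoot_covRoot h.posSemidef]
  refine (real_inner_le_norm _ _).trans ?_
  have := (Matrix.toEuclideanCLM (𝕜 := ℝ) S).le_opNorm x
  calc _ ≤ ‖Matrix.toEuclideanCLM (𝕜 := ℝ) S‖ * ‖x‖ * ‖x‖ := by gcongr
    _ ≤ B * ‖x‖ * ‖x‖ := by gcongr; exact h.norm_le
    _ = _ := by ring

theorem l2_eq_norm (a : Fin m → ℝ) : l2 a = ‖WithLp.toLp 2 a‖ := by
  rw [EuclideanSpace.norm_eq, l2]; simp

theorem l2_mulVec_le (h : IsDataCovariance S B) (a : Fin m → ℝ) :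
    l2 (S.mulVec a) ≤ B * l2 a := by
  rw [l2_eq_norm, l2_eq_norm]
  have h1 := (Matrix.toEuclideanCLM (𝕜 := ℝ) S).le_opNorm (WithLp.toLp 2 a)
  have h2 : Matrix.toEuclideanCLM (𝕜 := ℝ) S (WithLp.toLp 2 a) = WithLp.toLp 2 (S.mulVec a) := by
    simp
  rw [h2] at h1
  exact h1.trans (mul_le_mul_of_nonneg_right h.norm_le (norm_nonneg _))

theorem expDeriv_id : ExpDeriv (fun t => t) (fun _ => 1) 1 where
  continuous := continuous_id
  measurable := measurable_const
  pos := one_pos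
  bound t := by linarith [Real.add_one_le_exp (1 * |t|)]
  deriv_bound t := by
    rw [abs_one, one_mul]; exact Real.one_le_exp (by positivity)
  hasDerivAt := ⟨∅, Set.countable_empty, fun t _ => hasDerivAt_id t⟩

theorem synthesisBound_basis :
    SynthesisBound (fun i : Fin m => EuclideanSpace.basisFun (Fin m) ℝ i) 1 := by
  intro c
  rw [one_mul, l2_eq_norm]
  refine le_of_eq (congrArg _ ?_)
  ext j
  simp [Finset.sum_apply, Pi.single_apply]

theorem integral_coord_mul (i j : Fin m) :
    ∫ w : EuclideanSpace ℝ (Fin m), w i * w j ∂(stdGaussian (EuclideanSpace ℝ (Fin m))) =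
      (1 : Matrix (Fin m) (Fin m) ℝ) i j := by
  have h := covariance_eval_multivariateGaussian (ι := Fin m) (μ := 0) Matrix.PosSemidef.one i j
  rw [multivariateGaussian_zero_one, covariance] at h
  have h0 : ∀ i : Fin m, ∫ w : EuclideanSpace ℝ (Fin m), w i
      ∂(stdGaussian (EuclideanSpace ℝ (Fin m))) = 0 := fun i =>
    integral_strongDual_stdGaussian (EuclideanSpace.proj i)
  simpa [h0] using h

theorem integrable_coord_mul (i j : Fin m) :
    Integrable (fun w : EuclideanSpace ℝ (Fin m) => w i * w j)
      (stdGaussian (EuclideanSpace ℝ (Fin m))) := by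
  have h : ∀ i : Fin m, MemLp (fun w : EuclideanSpace ℝ (Fin m) => w i) 2
      (stdGaussian (EuclideanSpace ℝ (Fin m))) := fun i =>
    IsGaussian.memLp_dual (stdGaussian (EuclideanSpace ℝ (Fin m))) (EuclideanSpace.proj i) 2
      (by simp)
  exact (h i).integrable_mul (h j)

/-- The quantity is the quadratic form of `S` in the coordinates divided by `√m`, i.e. in features
with `σ = id` and the standard basis. Its mean is the normalized trace, which is one. -/
theorem measure_norm_covRoot_le [NeZero m] (h : IsDataCovariance S B) {τ : ℝ} (hτ : 0 < τ)
    (p : ℕ) :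
    stdGaussian (EuclideanSpace ℝ (Fin m)) {w | τ < |‖covRoot S w‖ ^ 2 / m - 1|} ≤
      incrConst (p + 1) 1 2 * m * ENNReal.ofReal ((2 * B / √m) ^ (p + 1)) /
        ENNReal.ofReal (τ ^ (p + 1)) := by
  have hB : 0 ≤ B := (norm_nonneg _).trans h.norm_le
  have hm : (0 : ℝ) < m := by exact_mod_cast NeZero.pos m
  set γ := stdGaussian (EuclideanSpace ℝ (Fin m))
  have hs : 0 < √(m : ℝ) := Real.sqrt_pos.2 hm
  have hsym : S.IsSymm := by
    have := h.posSemidef.isHermitian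
    rwa [Matrix.IsHermitian, Matrix.conjTranspose_eq_transpose_of_trivial] at this
  have hq := lintegral_quadratic_sub_pow_le expDeriv_id hs (κ := 1)
    (by simp [Real.sq_sqrt hm.le]) (synthesisBound_basis (m := m)) zero_le_one hsym hB
    (l2_mulVec_le h) p
  set ft := feat (fun t => t) (fun i : Fin m => EuclideanSpace.basisFun (Fin m) ℝ i) (√m)
  have hfe : ∀ w i, ft w i = w i / √m := by
    intro w i
    simp [ft, feat, PiLp.inner_apply]
  have hform : ∀ w, ft w ⬝ᵥ S.mulVec (ft w) = ∑ i, ∑ j, S i j / m * (w i * w j) := by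
    intro w
    simp only [dotProduct, Matrix.mulVec, hfe, Finset.mul_sum]
    refine Finset.sum_congr rfl fun i _ => Finset.sum_congr rfl fun j _ => ?_
    have : (m : ℝ) = √m * √m := (Real.mul_self_sqrt hm.le).symm
    rw [this]; field_simp
    rw [Real.sqrt_sq hs.le]
  have hnf : ∀ w, ‖covRoot S w‖ ^ 2 / m = ft w ⬝ᵥ S.mulVec (ft w) := by
    intro w
    rw [hform, norm_covRoot_sq h.posSemidef]
    simp only [dotProduct, Matrix.mulVec, Finset.mul_sum, Finset.sum_div]
    exact Finset.sum_congr rfl fun i _ => Finset.sum_congr rfl fun j _ => by ring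
  have hint : ∀ i ∈ Finset.univ, ∀ j ∈ Finset.univ, Integrable
      (fun w : EuclideanSpace ℝ (Fin m) => S i j / m * (w i * w j)) γ := fun i _ j _ =>
    (integrable_coord_mul i j).const_mul _
  have hint2 : Integrable (fun w => ft w ⬝ᵥ S.mulVec (ft w)) γ := by
    simp only [hform]
    exact integrable_finsetSum _ fun i hi => integrable_finsetSum _ (hint i hi)
  have hmean : ∫ w, ft w ⬝ᵥ S.mulVec (ft w) ∂γ = 1 := by
    simp only [hform]
    rw [integral_finsetSum _ fun i hi => integrable_finsetSum _ (hint i hi)]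
    have : ∀ i, ∫ w : EuclideanSpace ℝ (Fin m), ∑ j, S i j / m * (w i * w j) ∂γ = S i i / m := by
      intro i
      rw [integral_finsetSum _ (hint i (Finset.mem_univ i))]
      simp_rw [integral_const_mul]
      simp only [γ, integral_coord_mul, Matrix.one_apply]
      simp
    simp only [this]
    rw [← Finset.sum_div]
    exact h.trace_eq
  have hmeas : Measurable fun w => ft w ⬝ᵥ S.mulVec (ft w) - 1 := by
    simp only [hform]; fun_prop
  simp only [hnf]
  refine measure_gt_le_of_moment γ hmeas hτ (p + 1) ?_
  have h3 := (lintegral_sub_integral_pow_le γ hint2 p).trans hq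
  rw [hmean] at h3
  refine h3.trans (le_of_eq ?_)
  simp

variable {N : ℕ}

/-- The rows of the data matrix, scaled by `1 / √m`. -/
noncomputable def scaledRows (S : Matrix (Fin m) (Fin m) ℝ)
    (g : Fin N → EuclideanSpace ℝ (Fin m)) : Fin N → EuclideanSpace ℝ (Fin m) :=
  fun i => (√m)⁻¹ • covRoot S (g i)

/-- Regular data: bounded synthesis operator and almost normalized rows. -/
def IsRegular (ξ : Fin N → EuclideanSpace ℝ (Fin m)) (L τ : ℝ) : Prop :=
  SynthesisBound ξ L ∧ ∀ i, |‖ξ i‖ ^ 2 - 1| ≤ τ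

theorem measure_not_isRegular_le [NeZero m] (h : IsDataCovariance S B) {κ τ : ℝ}
    (hκ : (N : ℝ) ≤ κ * m) (hτ : 0 < τ) (p : ℕ) :
    (Measure.pi fun _ : Fin N => stdGaussian (EuclideanSpace ℝ (Fin m)))
      {g | ¬ IsRegular (scaledRows S g) (√B * √(2048 * (κ + 2))) τ} ≤
      ENNReal.ofReal (Real.exp (-N)) + N * (incrConst (p + 1) 1 2 * m *
        ENNReal.ofReal ((2 * B / √m) ^ (p + 1)) / ENNReal.ofReal (τ ^ (p + 1))) := by
  have hm : (0 : ℝ) < m := by exact_mod_cast NeZero.pos m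
  have hm1 : (1 : ℝ) ≤ m := by exact_mod_cast NeZero.one_le
  have hs : 0 < √(m : ℝ) := Real.sqrt_pos.2 hm
  set ϖ := Measure.pi fun _ : Fin N => stdGaussian (EuclideanSpace ℝ (Fin m))
  have hsub : {g : Fin N → EuclideanSpace ℝ (Fin m) |
      ¬ IsRegular (scaledRows S g) (√B * √(2048 * (κ + 2))) τ} ⊆
      {g | √(2048 * (N + Module.finrank ℝ (EuclideanSpace ℝ (Fin m)) + 1)) ≤ ‖synth g‖} ∪
        ⋃ i : Fin N, {g | τ < |‖covRoot S (g i)‖ ^ 2 / m - 1|} := by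
    intro g hg
    by_contra hc
    simp only [Set.mem_union, Set.mem_iUnion, Set.mem_ofPred_eq, not_or, not_le, not_exists,
      not_lt] at hc
    refine hg ⟨fun c => ?_, fun i => ?_⟩
    · have h1 : ∑ i, c i • scaledRows S g i = (√m)⁻¹ • covRoot S (synth g (WithLp.toLp 2 c)) := by
        rw [synth_apply, map_sum, Finset.smul_sum]
        refine Finset.sum_congr rfl fun i _ => ?_
        rw [map_smul, scaledRows, smul_comm]
      rw [h1, norm_smul, norm_inv, Real.norm_of_nonneg hs.le, l2_eq_norm]
      have h2 := (synth g).le_opNorm (WithLp.toLp 2 c)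
      have h3 : ‖synth g‖ ≤ √(2048 * (κ + 2)) * √m := by
        refine hc.1.le.trans ?_
        rw [← Real.sqrt_mul' _ hm.le]
        refine Real.sqrt_le_sqrt ?_
        rw [finrank_euclideanSpace_fin]
        -- Since `m ≥ 1`, `N + m + 1 ≤ (κ + 2) m`, which explains the constant in the operator norm
        -- bound.
        nlinarith
      calc (√m)⁻¹ * ‖covRoot S (synth g (WithLp.toLp 2 c))‖
          ≤ (√m)⁻¹ * (√B * (√(2048 * (κ + 2)) * √m * ‖WithLp.toLp 2 c‖)) := by
            gcongr
            refine (norm_covRoot_le h _).trans ?_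
            gcongr
            exact h2.trans (by gcongr)
        _ = _ := by field_simp
    · have h1 : ‖scaledRows S g i‖ ^ 2 = ‖covRoot S (g i)‖ ^ 2 / m := by
        rw [scaledRows, norm_smul, mul_pow, norm_inv, Real.norm_of_nonneg hs.le, inv_pow,
          Real.sq_sqrt hm.le]
        field_simp
      rw [h1]
      exact hc.2 i
  refine (measure_mono hsub).trans ((measure_union_le _ _).trans
    (add_le_add measure_norm_synth_tail ((measure_iUnion_fintype_le _ _).trans ?_)))
  calc _ ≤ ∑ _i : Fin N, (incrConst (p + 1) 1 2 * m *
        ENNReal.ofReal ((2 * B / √m) ^ (p + 1)) / ENNReal.ofReal (τ ^ (p + 1))) := by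
        refine Finset.sum_le_sum fun i _ => ?_
        refine le_trans (le_of_eq ?_) (measure_norm_covRoot_le h hτ p)
        refine (measurePreserving_eval (fun _ : Fin N => stdGaussian (EuclideanSpace ℝ (Fin m)))
          i).measure_preimage (s := {w | τ < |‖covRoot S w‖ ^ 2 / m - 1|}) ?_
        exact (isOpen_lt continuous_const (by fun_prop)).measurableSet.nullMeasurableSet
    _ = _ := by simp
end Covariance

/-! ### From the abstract model to independent standard Gaussian vectors -/

section Transport

theorem map_swap_uncurry_pi {m d : ℕ} (ρ : Measure ℝ) [IsProbabilityMeasure ρ] :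
    (Measure.pi fun _ : Fin d => Measure.pi fun _ : Fin m => ρ).map
      (fun w (p : Fin m × Fin d) => w p.2 p.1) = Measure.pi fun _ : Fin m × Fin d => ρ := by
  have hm : Measurable fun (w : Fin d → Fin m → ℝ) (p : Fin m × Fin d) => w p.2 p.1 := by fun_prop
  refine (Measure.pi_eq fun s hs => ?_).symm
  rw [Measure.map_apply hm (MeasurableSet.univ_pi hs)]
  have hpre : (fun (w : Fin d → Fin m → ℝ) (p : Fin m × Fin d) => w p.2 p.1) ⁻¹' Set.univ.pi s =
      Set.univ.pi fun α => Set.univ.pi fun j => s (j, α) := by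
    ext w
    simp only [Set.mem_preimage, Set.mem_univ_pi, Prod.forall]
    exact forall_comm
  rw [hpre, Measure.pi_pi]
  simp only [Measure.pi_pi]
  rw [Fintype.prod_prod_type_right]

variable {Ω : Type*} [MeasurableSpace Ω] {μ : Measure Ω} [IsProbabilityMeasure μ] {n d m : ℕ}
  {S : Matrix (Fin m) (Fin m) ℝ} {X : Ω → Matrix (Fin n) (Fin m) ℝ}
  {W : Ω → Matrix (Fin m) (Fin d) ℝ}

theorem IsModel.map_rows (h : IsModel μ S X W) :
    AEMeasurable (fun ω a => WithLp.toLp 2 (X ω a)) μ ∧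
    μ.map (fun ω a => WithLp.toLp 2 (X ω a)) =
      (Measure.pi fun _ : Fin n => stdGaussian (EuclideanSpace ℝ (Fin m))).map
        (fun g a => covRoot S (g a)) := by
  have hae : ∀ a, AEMeasurable (fun ω => WithLp.toLp 2 (X ω a)) μ := fun a =>
    (h.row_law a).aemeasurable
  refine ⟨aemeasurable_pi_lambda _ hae, ?_⟩
  have hind : iIndepFun (fun (a : Fin n) ω => WithLp.toLp 2 (X ω a)) μ :=
    h.row_indep.comp (fun _ x => WithLp.toLp 2 x) (fun _ => by fun_prop)
  rw [(iIndepFun_iff_map_fun_eq_pi_map hae).1 hind]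
  have h2 : ∀ a, μ.map (fun ω => WithLp.toLp 2 (X ω a)) =
      (stdGaussian (EuclideanSpace ℝ (Fin m))).map (covRoot S) := by
    intro a
    rw [(h.row_law a).map_eq, multivariateGaussian]
    simp [covRoot]
  simp_rw [h2]
  have h3 := measurePreserving_pi (fun _ : Fin n => stdGaussian (EuclideanSpace ℝ (Fin m)))
    (fun _ : Fin n => (stdGaussian (EuclideanSpace ℝ (Fin m))).map (covRoot S))
    (f := fun _ => covRoot S) (fun _ => ⟨by fun_prop, rfl⟩)
  exact h3.map_eq.symm

theorem IsModel.map_cols (h : IsModel μ S X W) :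
    AEMeasurable (fun ω α => WithLp.toLp 2 (fun j => W ω j α)) μ ∧
    μ.map (fun ω α => WithLp.toLp 2 (fun j => W ω j α)) =
      Measure.pi fun _ : Fin d => stdGaussian (EuclideanSpace ℝ (Fin m)) := by
  have hae : ∀ p : Fin m × Fin d, AEMeasurable (fun ω => W ω p.1 p.2) μ := fun p =>
    (h.entry_law p.1 p.2).aemeasurable
  have hae1 : AEMeasurable (fun ω (p : Fin m × Fin d) => W ω p.1 p.2) μ :=
    aemeasurable_pi_lambda _ hae
  have h1 : μ.map (fun ω (p : Fin m × Fin d) => W ω p.1 p.2) =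
      Measure.pi fun _ => gaussianReal 0 1 := by
    rw [(iIndepFun_iff_map_fun_eq_pi_map hae).1 h.entry_indep]
    simp_rw [(h.entry_law _ _).map_eq]
  let G : (Fin m × Fin d → ℝ) → Fin d → EuclideanSpace ℝ (Fin m) :=
    fun P α => WithLp.toLp 2 (fun j => P (j, α))
  have hG : Measurable G := by fun_prop
  have hcomp : (fun ω α => WithLp.toLp 2 (fun j => W ω j α)) =
      G ∘ fun ω (p : Fin m × Fin d) => W ω p.1 p.2 := rfl
  rw [hcomp]
  refine ⟨hG.comp_aemeasurable hae1, ?_⟩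
  rw [← AEMeasurable.map_map_of_aemeasurable hG.aemeasurable hae1, h1,
    ← map_swap_uncurry_pi, Measure.map_map hG (by fun_prop)]
  have h3 := measurePreserving_pi
    (fun _ : Fin d => Measure.pi fun _ : Fin m => gaussianReal 0 1)
    (fun _ : Fin d => stdGaussian (EuclideanSpace ℝ (Fin m)))
    (f := fun _ => WithLp.toLp 2) (fun _ => ⟨by fun_prop, map_pi_eq_stdGaussian⟩)
  exact h3.map_eq

/-- The joint law of the data and the weights in terms of independent standard Gaussian vectors. -/
theorem IsModel.measure_eq (h : IsModel μ S X W)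
    {s : Set ((Fin n → EuclideanSpace ℝ (Fin m)) × (Fin d → EuclideanSpace ℝ (Fin m)))}
    (hs : MeasurableSet s) :
    μ {ω | ((fun a => WithLp.toLp 2 (X ω a)), fun α => WithLp.toLp 2 (fun j => W ω j α)) ∈ s} =
      ((Measure.pi fun _ : Fin n => stdGaussian (EuclideanSpace ℝ (Fin m))).prod
        (Measure.pi fun _ : Fin d => stdGaussian (EuclideanSpace ℝ (Fin m))))
        {q | ((fun a => covRoot S (q.1 a)), q.2) ∈ s} := by
  obtain ⟨hX, hXl⟩ := h.map_rows
  obtain ⟨hW, hWl⟩ := h.map_cols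
  have hind : IndepFun (fun ω (a : Fin n) => WithLp.toLp 2 (X ω a))
      (fun ω (α : Fin d) => WithLp.toLp 2 (fun j => W ω j α)) μ :=
    h.indep.comp (φ := fun (x : Fin n → Fin m → ℝ) a => WithLp.toLp 2 (x a))
      (ψ := fun (w : Fin m → Fin d → ℝ) α => WithLp.toLp 2 (fun j => w j α))
      (by fun_prop) (by fun_prop)
  have hmap := (indepFun_iff_map_prod_eq_prod_map_map hX hW).1 hind
  rw [hXl, hWl] at hmap
  have hmp : (Measure.pi fun _ : Fin d => stdGaussian (EuclideanSpace ℝ (Fin m))) =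
      (Measure.pi fun _ : Fin d => stdGaussian (EuclideanSpace ℝ (Fin m))).map id := by simp
  have hcm : Measurable fun (g : Fin n → EuclideanSpace ℝ (Fin m)) a => covRoot S (g a) := by
    fun_prop
  rw [hmp, Measure.map_prod_map _ _ hcm measurable_id] at hmap
  have h1 := Measure.map_apply_of_aemeasurable (hX.prodMk hW) hs
  rw [hmap, Measure.map_apply (by fun_prop) hs] at h1
  exact h1.symm
end Transport

/-! ### From column forms to resolvents, and the symmetry under transposition -/

section Events
variable {T : Type*} [TopologicalSpace T] {n d : ℕ}

theorem continuous_colForm_apply {A : T → Matrix (Fin n) (Fin d) ℝ} (hA : Continuous A) {z : ℂ}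
    (hz : 0 < z.im) (α β i j : Fin d) : Continuous fun t => colForm (A t) z α β i j := by
  have h1 := continuous_dropCols hA α β
  have h2 : Continuous fun t => resolvent
      (dropCols (A t) α β * (dropCols (A t) α β).transpose) z :=
    continuous_pi fun a => continuous_pi fun b => continuous_resolvent_apply
      (h1.matrix_mul h1.matrix_transpose) (fun _ => isSymm_mul_transpose_self _) hz a b
  have h3 : Continuous fun t => (A t).map (fun x : ℝ => (x : ℂ)) :=
    hA.matrix_map Complex.continuous_ofReal
  exact (continuous_apply_apply i j).comp (h3.matrix_transpose.matrix_mul (h2.matrix_mul h3))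

theorem isClosed_resolventBounds {A : T → Matrix (Fin n) (Fin d) ℝ} (hA : Continuous A) {z : ℂ}
    (hz : 0 < z.im) (ε : ℝ) : IsClosed {t | ResolventBounds (A t) z ε} := by
  have h1 : ∀ i j, Continuous fun t => resolvent ((A t).transpose * A t) z i j := fun i j =>
    continuous_resolvent_apply (hA.matrix_transpose.matrix_mul hA)
      (fun t => by simp [Matrix.IsSymm, Matrix.transpose_mul]) hz i j
  have h2 : ∀ i j, Continuous fun t => resolvent (A t * (A t).transpose) z i j := fun i j =>
    continuous_resolvent_apply (hA.matrix_mul hA.matrix_transpose)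
      (fun t => isSymm_mul_transpose_self _) hz i j
  have h3 : Continuous fun t => normTrace (resolvent ((A t).transpose * A t) z) := by
    simp only [normTrace, Matrix.trace, Matrix.diag]
    fun_prop
  have h4 : Continuous fun t => normTrace (resolvent (A t * (A t).transpose) z) := by
    simp only [normTrace, Matrix.trace, Matrix.diag]
    fun_prop
  have he : {t | ResolventBounds (A t) z ε} =
      ((⋂ α, ⋂ β, ⋂ _ : α ≠ β, {t | ‖resolvent ((A t).transpose * A t) z α β‖ ≤ ε}) ∩
        (⋂ a, ⋂ b, ⋂ _ : a ≠ b, {t | ‖resolvent (A t * (A t).transpose) z a b‖ ≤ ε})) ∩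
      ((⋂ α, {t | ‖resolvent ((A t).transpose * A t) z α α -
          normTrace (resolvent ((A t).transpose * A t) z)‖ ≤ ε}) ∩
        (⋂ a, {t | ‖resolvent (A t * (A t).transpose) z a a -
          normTrace (resolvent (A t * (A t).transpose) z)‖ ≤ ε})) := by
    ext t
    simp only [Set.mem_inter_iff, Set.mem_iInter, Set.mem_ofPred_eq]
    exact ⟨fun h => ⟨⟨h.1, h.2⟩, h.3, h.4⟩, fun h => ⟨h.1.1, h.1.2, h.2.1, h.2.2⟩⟩
  rw [he]
  refine ((isClosed_iInter fun α => isClosed_iInter fun β => isClosed_iInter fun _ => ?_).inter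
    (isClosed_iInter fun α => isClosed_iInter fun β => isClosed_iInter fun _ => ?_)).inter
    ((isClosed_iInter fun α => ?_).inter (isClosed_iInter fun α => ?_))
  · exact isClosed_le (h1 α β).norm continuous_const
  · exact isClosed_le (h2 α β).norm continuous_const
  · exact isClosed_le ((h1 α α).sub h3).norm continuous_const
  · exact isClosed_le ((h2 α α).sub h4).norm continuous_const

/-- Small column forms give the bounds for one of the two resolvents. -/
theorem resolvent_bounds_of_colForm_le {A : Matrix (Fin n) (Fin d) ℝ} {z : ℂ} (hz : 0 < z.im)
    {t : ℝ} (ht : 0 ≤ t) (h : ∀ α β, α ≠ β → ‖colForm A z α β α β‖ ≤ 2 * t ∧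
      ‖colForm A z α β α α - colForm A z α β β β‖ ≤ 2 * t) :
    (∀ α β, α ≠ β → ‖resolvent (A.transpose * A) z α β‖ ≤ 2 * z.im⁻¹ ^ 2 * ‖z‖ * (2 * t)) ∧
    ∀ α, ‖resolvent (A.transpose * A) z α α - normTrace (resolvent (A.transpose * A) z)‖ ≤
      2 * z.im⁻¹ ^ 2 * ‖z‖ * (2 * t) := by
  refine ⟨fun α β hαβ => (norm_resolvent_offDiag_le A hz hαβ).trans ?_, fun α => ?_⟩
  · gcongr
    exact (h α β hαβ).1
  · set R := resolvent (A.transpose * A) z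
    set ε := 2 * z.im⁻¹ ^ 2 * ‖z‖ * (2 * t)
    have hε : 0 ≤ ε := by positivity
    have hd : (0 : ℝ) < d := by exact_mod_cast α.pos
    have hd' : (d : ℂ) ≠ 0 := by exact_mod_cast hd.ne'
    have h1 : ∀ β, ‖R α α - R β β‖ ≤ ε := by
      intro β
      by_cases hαβ : α = β
      · simpa [hαβ] using hε
      · refine (norm_resolvent_diag_sub_le A hz hαβ).trans ?_
        exact mul_le_mul_of_nonneg_left (h α β hαβ).2 (by positivity)
    -- The deviation from the normalized trace is an average of differences of diagonal entries.
    have h2 : R α α - normTrace R = (∑ β, (R α α - R β β)) / d := by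
      rw [normTrace, Matrix.trace, Finset.sum_sub_distrib]
      simp only [Matrix.diag, Finset.sum_const, Finset.card_univ, Fintype.card_fin, nsmul_eq_mul]
      field_simp
    rw [h2, norm_div, Complex.norm_natCast, div_le_iff₀ hd]
    refine (norm_sum_le _ _).trans ((Finset.sum_le_sum fun β _ => h1 β).trans (le_of_eq ?_))
    simp [mul_comm]

variable {m : ℕ}

theorem featureMatrix_eq (σ : ℝ → ℝ) (S : Matrix (Fin m) (Fin m) ℝ)
    (g : Fin n → EuclideanSpace ℝ (Fin m)) (w : Fin d → EuclideanSpace ℝ (Fin m)) :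
    featureMatrix σ (Matrix.of fun a j => covRoot S (g a) j) (Matrix.of fun j α => w α j) =
      featMat σ (scaledRows S g) (√n) w := by
  ext a α
  simp only [featureMatrix, featMat, feat, scaledRows, Matrix.of_apply, Matrix.mul_apply]
  congr 2
  rw [real_inner_smul_left, PiLp.inner_apply, div_eq_inv_mul]
  congr 1
  exact Finset.sum_congr rfl fun j _ => by simp [mul_comm]

/-- Self-adjointness of the covariance root lets it be moved from the data to the weights, so the
rows of `A` are feature vectors built from `scaledRows S w`. This yields the second resolvent
without a separate argument. -/
theorem transpose_featMat (σ : ℝ → ℝ) (S : Matrix (Fin m) (Fin m) ℝ)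
    (g : Fin n → EuclideanSpace ℝ (Fin m)) (w : Fin d → EuclideanSpace ℝ (Fin m)) (s : ℝ) :
    (featMat σ (scaledRows S g) s w).transpose = featMat σ (scaledRows S w) s g := by
  ext α a
  simp only [Matrix.transpose_apply, featMat, feat, scaledRows, Matrix.of_apply]
  rw [real_inner_smul_left, real_inner_smul_left, inner_covRoot_comm]

theorem continuous_featMat {σ : ℝ → ℝ} (hσ : Continuous σ) (S : Matrix (Fin m) (Fin m) ℝ) (s : ℝ) :
    Continuous fun q : (Fin n → EuclideanSpace ℝ (Fin m)) × (Fin d → EuclideanSpace ℝ (Fin m)) =>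
      featMat σ (scaledRows S q.1) s q.2 := by
  refine continuous_pi fun a => continuous_pi fun γ => ?_
  simp only [featMat, feat, scaledRows, Matrix.of_apply]
  fun_prop

theorem continuous_featureMatrix {σ : ℝ → ℝ} (hσ : Continuous σ) :
    Continuous fun q : (Fin n → EuclideanSpace ℝ (Fin m)) × (Fin d → EuclideanSpace ℝ (Fin m)) =>
      featureMatrix σ (Matrix.of fun a j => q.1 a j) (Matrix.of fun j α => q.2 α j) := by
  refine continuous_pi fun a => continuous_pi fun γ => ?_
  simp only [featureMatrix, Matrix.of_apply, Matrix.mul_apply]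
  fun_prop

/-- The event that some column form is large, on the product space. -/
def largeFormsProd (σ : ℝ → ℝ) (S : Matrix (Fin m) (Fin m) ℝ) (s : ℝ) (z : ℂ) (t : ℝ) :
    Set ((Fin n → EuclideanSpace ℝ (Fin m)) × (Fin d → EuclideanSpace ℝ (Fin m))) :=
  {q | q.2 ∈ largeForms σ (scaledRows S q.1) s z t}

theorem isOpen_largeFormsProd {σ : ℝ → ℝ} (hσ : Continuous σ) (S : Matrix (Fin m) (Fin m) ℝ)
    (s : ℝ) {z : ℂ} (hz : 0 < z.im) (t : ℝ) :
    IsOpen (largeFormsProd (n := n) (d := d) σ S s z t) := by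
  have hA := continuous_featMat (n := n) (d := d) hσ S s
  have he : largeFormsProd (n := n) (d := d) σ S s z t = ⋃ α, ⋃ β, ⋃ _ : α ≠ β,
      ({q | 2 * t < ‖colForm (featMat σ (scaledRows S q.1) s q.2) z α β α β‖} ∪
        {q | 2 * t < ‖colForm (featMat σ (scaledRows S q.1) s q.2) z α β α α -
          colForm (featMat σ (scaledRows S q.1) s q.2) z α β β β‖}) := by
    ext q
    simp only [largeFormsProd, largeForms, Set.mem_ofPred_eq, Set.mem_iUnion, Set.mem_union,
      exists_prop]
  rw [he]
  refine isOpen_iUnion fun α => isOpen_iUnion fun β => isOpen_iUnion fun _ => ?_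
  refine (isOpen_lt continuous_const (continuous_colForm_apply hA hz α β α β).norm).union
    (isOpen_lt continuous_const ?_)
  exact ((continuous_colForm_apply hA hz α β α α).sub
    (continuous_colForm_apply hA hz α β β β)).norm

end Events

/-! ### Choice of exponents -/

section TailBounds

/-- Used with `r` the set of irregular data, on which the slice is bounded by one; the measurable
hull avoids having to prove `r` measurable. -/
theorem prod_measure_le_of_slices {α β : Type*} [MeasurableSpace α] [MeasurableSpace β]
    (μ : Measure α) (ν : Measure β) [IsProbabilityMeasure μ] [IsProbabilityMeasure ν]
    {s : Set (α × β)} (hs : MeasurableSet s) (r : Set α) {c : ℝ≥0∞}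
    (h : ∀ a, a ∉ r → ν (Prod.mk a ⁻¹' s) ≤ c) : μ.prod ν s ≤ μ r + c := by
  rw [Measure.prod_apply hs]
  have hm := measurableSet_toMeasurable μ r
  calc ∫⁻ a, ν (Prod.mk a ⁻¹' s) ∂μ ≤ ∫⁻ a, ((toMeasurable μ r).indicator 1 a + c) ∂μ := by
        refine lintegral_mono fun a => ?_
        by_cases ha : a ∈ r
        · rw [Set.indicator_of_mem (subset_toMeasurable μ r ha)]
          exact prob_le_one.trans le_self_add
        · exact (h a ha).trans le_add_self
    _ = μ r + c := by
        rw [lintegral_add_right _ measurable_const, lintegral_indicator_one hm,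
          measure_toMeasurable]
        simp

theorem exp_neg_le_rpow {κ D : ℝ} (hκ : 1 ≤ κ) :
    ∃ K : ℝ, 0 ≤ K ∧ ∀ n N : ℕ, 0 < n → (n : ℝ) ≤ κ * N → Real.exp (-N) ≤ K * (n : ℝ) ^ (-D) := by
  set k := ⌈D⌉₊
  refine ⟨k.factorial * κ ^ k, by positivity, fun n N hn hN => ?_⟩
  have hn' : (1 : ℝ) ≤ n := by exact_mod_cast hn
  have hNpos : (0 : ℝ) < N := by
    by_contra h
    push Not at h
    nlinarith
  have h1 := Real.pow_div_factorial_le_exp (N : ℝ) hNpos.le k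
  have hk : (0 : ℝ) < k.factorial := by exact_mod_cast k.factorial_pos
  have h2 : (n : ℝ) ^ (-(k : ℝ)) ≤ (n : ℝ) ^ (-D) :=
    Real.rpow_le_rpow_of_exponent_le hn' (neg_le_neg (Nat.le_ceil D))
  refine le_trans ?_ (mul_le_mul_of_nonneg_left h2 (by positivity))
  rw [Real.rpow_neg (by positivity), Real.rpow_natCast, Real.exp_neg, ← div_eq_mul_inv,
    inv_le_comm₀ (Real.exp_pos _) (by positivity), inv_div]
  refine le_trans ?_ h1
  rw [div_le_div_iff₀ (by positivity) hk]
  calc (n : ℝ) ^ k * k.factorial ≤ (κ * N) ^ k * k.factorial := by gcongr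
    _ = _ := by ring

theorem pow_four_mul_rpow_le {n : ℕ} (hn : 0 < n) {δ D : ℝ} {p : ℕ} (hp : D + 4 ≤ δ * p) :
    (n : ℝ) ^ 4 * ((n : ℝ) ^ (-δ)) ^ p ≤ (n : ℝ) ^ (-D) := by
  have hn' : (1 : ℝ) ≤ n := by exact_mod_cast hn
  have hn0 : (0 : ℝ) < n := by linarith
  rw [← Real.rpow_natCast ((n : ℝ) ^ (-δ)), ← Real.rpow_mul hn0.le,
    ← Real.rpow_natCast (n : ℝ) 4, ← Real.rpow_add hn0]
  refine Real.rpow_le_rpow_of_exponent_le hn' ?_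
  push_cast
  linarith

theorem ennreal_mul_ofReal {K : ℝ≥0∞} (hK : K ≠ ⊤) (x : ℝ) :
    K * ENNReal.ofReal x = ENNReal.ofReal (K.toReal * x) := by
  rw [ENNReal.ofReal_mul ENNReal.toReal_nonneg, ENNReal.ofReal_toReal hK]

/-- Tail bound for the column forms on the product space. -/
theorem measure_largeFormsProd_le {σ ψ : ℝ → ℝ} {b κ δ c : ℝ} (B D : ℝ) (h : ExpDeriv σ ψ b)
    (hσ : ∫ x, σ x ∂(gaussianReal 0 1) = 0) (hκ : 1 ≤ κ) (hδ : 0 < δ) (hc : 0 < c) :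
    ∃ K : ℝ, 0 ≤ K ∧ ∀ n N M m : ℕ, 0 < n → 0 < N → 0 < m → (N : ℝ) ≤ κ * n → (M : ℝ) ≤ κ * n →
      (m : ℝ) ≤ κ * n → (n : ℝ) ≤ κ * N → (n : ℝ) ≤ κ * m →
      ∀ S : Matrix (Fin m) (Fin m) ℝ, IsDataCovariance S B →
      ∀ z : ℂ, c * (n : ℝ) ^ (-δ) ≤ z.im →
      ((Measure.pi fun _ : Fin N => stdGaussian (EuclideanSpace ℝ (Fin m))).prod
        (Measure.pi fun _ : Fin M => stdGaussian (EuclideanSpace ℝ (Fin m))))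
        (largeFormsProd σ S (√n) z ((n : ℝ) ^ (3 * δ - 1 / 2))) ≤
        ENNReal.ofReal (K * (n : ℝ) ^ (-D)) := by
  obtain ⟨K₁, hK₁, hexp⟩ := exp_neg_le_rpow (D := D) hκ
  -- Each moment gains `n ^ (-δ)`. The `4` pays for the factors `M²` from the union bound and `N²`
  -- from the moment bounds.
  obtain ⟨p, hp⟩ : ∃ p : ℕ, D + 4 ≤ δ * (p + 1 : ℕ) := by
    obtain ⟨p, hp⟩ := exists_nat_ge ((D + 4) / δ)
    refine ⟨p, ?_⟩
    rw [div_le_iff₀ hδ] at hp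
    push_cast
    nlinarith
  -- The square appears because `N ≤ κ n ≤ κ² m`.
  set L : ℝ := √B * √(2048 * (κ ^ 2 + 2)) with hL
  have hL0 : 0 ≤ L := by positivity
  set I := incrConst (p + 1) 1 2 with hI
  have hIt : I ≠ ⊤ := (incrConst_lt_top _ _ _).ne
  set F := formConst (p + 1) L b κ with hF
  have hFt : F ≠ ⊤ := (formConst_lt_top _ _ _ _).ne
  refine ⟨K₁ + I.toReal * (κ ^ 2 * |2 * B * √κ| ^ (p + 1)) +
    F.toReal * (2 * κ ^ 4 * c⁻¹ ^ (p + 1)), by positivity, ?_⟩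
  intro n N M m hn hN hm hNn hMn hmn hnN hnm S hS z hz
  have hB : 0 ≤ B := (norm_nonneg _).trans hS.norm_le
  have : NeZero N := ⟨hN.ne'⟩
  have : NeZero m := ⟨hm.ne'⟩
  have hn1 : (1 : ℝ) ≤ n := by exact_mod_cast hn
  have hn0 : (0 : ℝ) < n := by linarith
  have hm0 : (0 : ℝ) < m := by exact_mod_cast hm
  have hzpos : 0 < z.im := lt_of_lt_of_le (by positivity) hz
  have hsq : √(n : ℝ) = (n : ℝ) ^ (1 / 2 : ℝ) := Real.sqrt_eq_rpow _
  have hs : 0 < √(n : ℝ) := Real.sqrt_pos.2 hn0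
  -- With `η⁻¹ ≤ c⁻¹ n ^ δ`, the forms are of order `η⁻¹ τ`, at most of order `n ^ (2 δ - 1/2)`; the
  -- threshold `t` exceeds this by `n ^ δ`.
  set τ : ℝ := (n : ℝ) ^ (δ - 1 / 2) with hτ
  set t : ℝ := (n : ℝ) ^ (3 * δ - 1 / 2) with ht
  have hτ0 : 0 < τ := by positivity
  have ht0 : 0 < t := by positivity
  have hsτ : 1 / √(n : ℝ) ≤ τ := by
    rw [hsq, one_div, ← Real.rpow_neg hn0.le]
    exact Real.rpow_le_rpow_of_exponent_le hn1 (by linarith)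
  have hreg := measure_not_isRegular_le (N := N) hS (κ := κ ^ 2) (by nlinarith) hτ0 p
  have hslice : ∀ g : Fin N → EuclideanSpace ℝ (Fin m),
      g ∉ {g | ¬ IsRegular (scaledRows S g) L τ} →
      (Measure.pi fun _ : Fin M => stdGaussian (EuclideanSpace ℝ (Fin m)))
        (Prod.mk g ⁻¹' largeFormsProd σ S (√n) z t) ≤
        M ^ 2 * (2 * (F * N ^ 2 *
        ENNReal.ofReal ((z.im⁻¹ * τ) ^ (p + 1)) / ENNReal.ofReal (t ^ (p + 1)))) := by
    intro g hg
    have hg' : IsRegular (scaledRows S g) L τ := by simpa using hg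
    exact measure_largeForms_le h hσ hs (by rwa [Real.sq_sqrt hn0.le]) hg'.1 hL0 hsτ hg'.2 ht0
      hzpos p
  refine (prod_measure_le_of_slices _ _
    (isOpen_largeFormsProd h.continuous S (√n) hzpos t).measurableSet _ hslice).trans ?_
  have hpow := pow_four_mul_rpow_le hn hp
  have h1 : ENNReal.ofReal (Real.exp (-N)) ≤ ENNReal.ofReal (K₁ * (n : ℝ) ^ (-D)) :=
    ENNReal.ofReal_le_ofReal (hexp n N hn hnN)
  have h2 : (N : ℝ≥0∞) * (I * m * ENNReal.ofReal ((2 * B / √m) ^ (p + 1)) /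
      ENNReal.ofReal (τ ^ (p + 1))) ≤
      ENNReal.ofReal (I.toReal * (κ ^ 2 * |2 * B * √κ| ^ (p + 1)) * (n : ℝ) ^ (-D)) := by
    have e : (N : ℝ≥0∞) * (I * m * ENNReal.ofReal ((2 * B / √m) ^ (p + 1)) /
      ENNReal.ofReal (τ ^ (p + 1))) =
        I * ENNReal.ofReal (N * m * (2 * B / √m / τ) ^ (p + 1)) := by
      rw [mul_div_assoc, ← ENNReal.ofReal_div_of_pos (by positivity), ← div_pow,
        ENNReal.ofReal_mul (by positivity), ENNReal.ofReal_mul (by positivity),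
        ENNReal.ofReal_natCast, ENNReal.ofReal_natCast]
      ring
    rw [e, ennreal_mul_ofReal hIt]
    refine ENNReal.ofReal_le_ofReal ?_
    rw [mul_assoc I.toReal]
    refine mul_le_mul_of_nonneg_left ?_ ENNReal.toReal_nonneg
    have h3 : 2 * B / √m / τ ≤ |2 * B * √κ| * (n : ℝ) ^ (-δ) := by
      have h4 : √(n : ℝ) ≤ √κ * √m := by
        rw [← Real.sqrt_mul (by linarith)]; exact Real.sqrt_le_sqrt hnm
      have h5 : τ * (n : ℝ) ^ (-δ) = (√n)⁻¹ := by
        rw [hτ, ← Real.rpow_add hn0, hsq, ← Real.rpow_neg hn0.le]; ring_nf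
      rw [abs_of_nonneg (by positivity), div_le_iff₀ hτ0, mul_assoc, mul_comm _ τ, h5,
        div_le_iff₀ (Real.sqrt_pos.2 hm0)]
      calc 2 * B = 2 * B * (√n * (√n)⁻¹) := by rw [mul_inv_cancel₀ hs.ne', mul_one]
        _ ≤ 2 * B * (√κ * √m * (√n)⁻¹) := by gcongr
        _ = _ := by ring
    calc (N : ℝ) * m * (2 * B / √m / τ) ^ (p + 1)
        ≤ κ * n * (κ * n) * (|2 * B * √κ| * (n : ℝ) ^ (-δ)) ^ (p + 1) := by gcongr
      _ = κ ^ 2 * |2 * B * √κ| ^ (p + 1) * ((n : ℝ) ^ 2 * ((n : ℝ) ^ (-δ)) ^ (p + 1)) := by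
          rw [mul_pow]; ring
      _ ≤ κ ^ 2 * |2 * B * √κ| ^ (p + 1) * (n : ℝ) ^ (-D) := by
          refine mul_le_mul_of_nonneg_left (le_trans ?_ hpow) (by positivity)
          gcongr
          norm_num
  have h3 : (M : ℝ≥0∞) ^ 2 * (2 * (F * N ^ 2 *
        ENNReal.ofReal ((z.im⁻¹ * τ) ^ (p + 1)) / ENNReal.ofReal (t ^ (p + 1)))) ≤
      ENNReal.ofReal (F.toReal * (2 * κ ^ 4 * c⁻¹ ^ (p + 1)) * (n : ℝ) ^ (-D)) := by
    have e : (M : ℝ≥0∞) ^ 2 * (2 * (F * N ^ 2 *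
        ENNReal.ofReal ((z.im⁻¹ * τ) ^ (p + 1)) / ENNReal.ofReal (t ^ (p + 1)))) =
        F * ENNReal.ofReal (2 * (M : ℝ) ^ 2 * (N : ℝ) ^ 2 * (z.im⁻¹ * τ / t) ^ (p + 1)) := by
      rw [mul_div_assoc, ← ENNReal.ofReal_div_of_pos (by positivity), ← div_pow,
        ENNReal.ofReal_mul (by positivity), ENNReal.ofReal_mul (by positivity),
        ENNReal.ofReal_mul (by positivity), ENNReal.ofReal_pow (by positivity : (0 : ℝ) ≤ M),
        ENNReal.ofReal_pow (by positivity : (0 : ℝ) ≤ N),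
        ENNReal.ofReal_natCast, ENNReal.ofReal_natCast, ENNReal.ofReal_ofNat]
      ring
    rw [e, ennreal_mul_ofReal hFt]
    refine ENNReal.ofReal_le_ofReal ?_
    rw [mul_assoc F.toReal]
    refine mul_le_mul_of_nonneg_left ?_ ENNReal.toReal_nonneg
    have h4 : z.im⁻¹ * τ / t ≤ c⁻¹ * (n : ℝ) ^ (-δ) := by
      have h5 : z.im⁻¹ ≤ c⁻¹ * (n : ℝ) ^ δ := by
        have h6 : z.im⁻¹ ≤ (c * (n : ℝ) ^ (-δ))⁻¹ := inv_anti₀ (by positivity) hz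
        rwa [mul_inv, Real.rpow_neg hn0.le, inv_inv] at h6
      rw [div_le_iff₀ ht0]
      calc z.im⁻¹ * τ ≤ c⁻¹ * (n : ℝ) ^ δ * τ := by gcongr
        _ = c⁻¹ * (n : ℝ) ^ (-δ) * t := by
            rw [hτ, ht, mul_assoc, mul_assoc, ← Real.rpow_add hn0, ← Real.rpow_add hn0]; ring_nf
    have h40 : 0 ≤ z.im⁻¹ * τ / t := by positivity
    calc 2 * (M : ℝ) ^ 2 * (N : ℝ) ^ 2 * (z.im⁻¹ * τ / t) ^ (p + 1)
        ≤ 2 * (κ * n) ^ 2 * (κ * n) ^ 2 * (c⁻¹ * (n : ℝ) ^ (-δ)) ^ (p + 1) := by gcongr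
      _ = 2 * κ ^ 4 * c⁻¹ ^ (p + 1) * ((n : ℝ) ^ 4 * ((n : ℝ) ^ (-δ)) ^ (p + 1)) := by
          rw [mul_pow c⁻¹]; ring
      _ ≤ 2 * κ ^ 4 * c⁻¹ ^ (p + 1) * (n : ℝ) ^ (-D) :=
          mul_le_mul_of_nonneg_left hpow (by positivity)
  refine (add_le_add (hreg.trans (add_le_add h1 h2)) h3).trans (le_of_eq ?_)
  rw [← ENNReal.ofReal_add (by positivity) (by positivity),
    ← ENNReal.ofReal_add (by positivity) (by positivity)]
  congr 1
  ring

theorem resolventBounds_of_not_largeForms {n d m : ℕ} (hn : 0 < n) {σ : ℝ → ℝ}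
    {S : Matrix (Fin m) (Fin m) ℝ} {c C δ : ℝ} (hc : 0 < c) {z : ℂ}
    (hz : z ∈ allowable c C δ n)
    {g : Fin n → EuclideanSpace ℝ (Fin m)} {w : Fin d → EuclideanSpace ℝ (Fin m)}
    (h₁ : (g, w) ∉ largeFormsProd σ S (√n) z ((n : ℝ) ^ (3 * δ - 1 / 2)))
    (h₂ : (w, g) ∉ largeFormsProd σ S (√n) z ((n : ℝ) ^ (3 * δ - 1 / 2))) :
    ResolventBounds (featMat σ (scaledRows S g) (√n) w) z
      (8 * C * c⁻¹ ^ 2 * (n : ℝ) ^ (6 * δ - 1 / 2)) := by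
  obtain ⟨hre, him, him'⟩ := hz
  have hn0 : (0 : ℝ) < n := by exact_mod_cast hn
  have hzpos : 0 < z.im := lt_of_lt_of_le (by positivity) him
  have h5 : z.im⁻¹ ≤ c⁻¹ * (n : ℝ) ^ δ := by
    have h6 : z.im⁻¹ ≤ (c * (n : ℝ) ^ (-δ))⁻¹ := inv_anti₀ (by positivity) him
    rwa [mul_inv, Real.rpow_neg hn0.le, inv_inv] at h6
  have h6 : ‖z‖ ≤ 2 * (C * (n : ℝ) ^ δ) := by
    have := Complex.norm_le_abs_re_add_abs_im z
    rw [abs_of_pos hzpos] at this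
    linarith
  -- The exponent `6 δ` is `2 δ` from `η⁻²`, `δ` from `‖z‖` and `3 δ` from the threshold.
  have hε : 2 * z.im⁻¹ ^ 2 * ‖z‖ * (2 * (n : ℝ) ^ (3 * δ - 1 / 2)) ≤
      8 * C * c⁻¹ ^ 2 * (n : ℝ) ^ (6 * δ - 1 / 2) := by
    calc _ ≤ 2 * (c⁻¹ * (n : ℝ) ^ δ) ^ 2 * (2 * (C * (n : ℝ) ^ δ)) *
          (2 * (n : ℝ) ^ (3 * δ - 1 / 2)) := by gcongr
      _ = 8 * C * c⁻¹ ^ 2 * ((n : ℝ) ^ δ * (n : ℝ) ^ δ * (n : ℝ) ^ δ *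
          (n : ℝ) ^ (3 * δ - 1 / 2)) := by ring
      _ = _ := by
          rw [← Real.rpow_add hn0, ← Real.rpow_add hn0, ← Real.rpow_add hn0]
          ring_nf
  have key : ∀ {a b : ℕ} {x : Fin a → EuclideanSpace ℝ (Fin m)}
      {y : Fin b → EuclideanSpace ℝ (Fin m)},
      (x, y) ∉ largeFormsProd σ S (√n) z ((n : ℝ) ^ (3 * δ - 1 / 2)) → _ := fun {a b x y} hxy =>
    resolvent_bounds_of_colForm_le (A := featMat σ (scaledRows S x) (√n) y) hzpos
      (t := (n : ℝ) ^ (3 * δ - 1 / 2)) (by positivity) (fun α β hαβ => by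
        simp only [largeFormsProd, largeForms, Set.mem_ofPred_eq, not_exists, not_and, not_or,
          not_lt] at hxy
        exact hxy α β hαβ)
  have k₁ := key h₁
  have k₂ := key h₂
  rw [← transpose_featMat, Matrix.transpose_transpose] at k₂
  exact ⟨fun α β hαβ => (k₁.1 α β hαβ).trans hε, fun a b hab => (k₂.1 a b hab).trans hε,
    fun α => (k₁.2 α).trans hε, fun a => (k₂.2 a).trans hε⟩

end TailBounds

end RandomFeatures

/-! ### Assembly -/

open RandomFeatures in
theorem mainTheorem8 :
    -- a universal factor `K` relating the exponent in the bound to that of the spectral domain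
    ∃ K : ℝ, 0 < K ∧
    ∀ (δ : ℝ), 0 < δ →
    -- constants of the allowable set, of the covariance bound and of the aspect ratios
    ∀ (c C B κ : ℝ), 0 < c → 0 < C →
    ∀ (σ : ℝ → ℝ) (C₀ C₁ : ℝ), RandomFeatures.IsActivation σ C₀ C₁ →
    ∃ C' : ℝ, 0 < C' ∧ ∀ D : ℝ, 0 < D → ∃ CD : ℝ, 0 < CD ∧
      ∀ (n d n₀ : ℕ), 0 < n → 0 < d → 0 < n₀ →
        (d : ℝ) ≤ κ * n → (n : ℝ) ≤ κ * d → (n₀ : ℝ) ≤ κ * n → (n : ℝ) ≤ κ * n₀ →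
      ∀ (S : Matrix (Fin n₀) (Fin n₀) ℝ), RandomFeatures.IsDataCovariance S B →
      ∀ (Ω : Type*) [MeasurableSpace Ω] (μ : MeasureTheory.Measure Ω)
        [MeasureTheory.IsProbabilityMeasure μ]
        (X : Ω → Matrix (Fin n) (Fin n₀) ℝ) (W : Ω → Matrix (Fin n₀) (Fin d) ℝ),
        RandomFeatures.IsModel μ S X W →
      ∀ z ∈ RandomFeatures.allowable c C δ n,
        1 - CD * (n : ℝ) ^ (-D) ≤
          μ.real {ω | RandomFeatures.ResolventBounds (RandomFeatures.featureMatrix σ (X ω) (W ω)) z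
            (C' * (n : ℝ) ^ (K * δ - 1 / 2))} := by
  refine ⟨6, by norm_num, fun δ hδ c C B κ hc hC σ C₀ C₁ hσ =>
    ⟨8 * C * c⁻¹ ^ 2, by positivity, fun D _ => ?_⟩⟩
  obtain ⟨ψ, b, hψ⟩ := hσ.exists_expDeriv
  -- The tail estimate needs a ratio bound of at least one, hence `max κ 1`.
  obtain ⟨K, hK, htail⟩ := measure_largeFormsProd_le B D hψ hσ.centred (le_max_right κ 1) hδ hc
  refine ⟨2 * K + 1, by positivity, ?_⟩
  intro n d m hn hd hm hdn hnd hmn hnm S hS Ω _ μ _ X W hmod z hz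
  have hn0 : (0 : ℝ) < n := by exact_mod_cast hn
  have hd0 : (0 : ℝ) < d := by exact_mod_cast hd
  have hm0 : (0 : ℝ) < m := by exact_mod_cast hm
  have hzpos : 0 < z.im := lt_of_lt_of_le (by positivity) hz.2.1
  have up : ∀ {x y : ℝ}, 0 < y → x ≤ κ * y → x ≤ max κ 1 * y := fun hy hxy =>
    hxy.trans (mul_le_mul_of_nonneg_right (le_max_left _ _) hy.le)
  have hnn : (n : ℝ) ≤ max κ 1 * n := le_mul_of_one_le_left hn0.le (le_max_right _ _)
  -- The tail bound is applied twice, once with the data fixed and the weights as columns and once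
  -- with the roles exchanged; the normalization `√n` is the same in both.
  have t₁ := htail n n d m hn hn hm hnn (up hn0 hdn) (up hn0 hmn) hnn (up hm0 hnm) S hS z hz.2.1
  have t₂ := htail n d n m hn hd hm (up hn0 hdn) hnn (up hn0 hmn) (up hd0 hnd) (up hm0 hnm)
    S hS z hz.2.1
  set s : Set ((Fin n → EuclideanSpace ℝ (Fin m)) × (Fin d → EuclideanSpace ℝ (Fin m))) :=
    {q | ResolventBounds (featureMatrix σ (Matrix.of fun a j => q.1 a j)
      (Matrix.of fun j α => q.2 α j)) z (8 * C * c⁻¹ ^ 2 * (n : ℝ) ^ (6 * δ - 1 / 2))} with hs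
  have hsm : MeasurableSet s :=
    (isClosed_resolventBounds (continuous_featureMatrix hσ.continuous) hzpos _).measurableSet
  have hcompl := hmod.measure_eq hsm.compl
  set γ₁ := Measure.pi fun _ : Fin n => stdGaussian (EuclideanSpace ℝ (Fin m))
  set γ₂ := Measure.pi fun _ : Fin d => stdGaussian (EuclideanSpace ℝ (Fin m))
  set t : ℝ := (n : ℝ) ^ (3 * δ - 1 / 2)
  have hsub : {q : (Fin n → EuclideanSpace ℝ (Fin m)) × (Fin d → EuclideanSpace ℝ (Fin m)) |
      ((fun a => covRoot S (q.1 a)), q.2) ∈ sᶜ} ⊆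
      largeFormsProd σ S (√n) z t ∪ Prod.swap ⁻¹' largeFormsProd σ S (√n) z t := by
    rintro ⟨g, w⟩ hq
    by_contra hc'
    rw [Set.mem_union, not_or] at hc'
    refine hq ?_
    have := resolventBounds_of_not_largeForms hn hc hz hc'.1 hc'.2
    rw [← featureMatrix_eq] at this
    exact this
  have hswap : (γ₁.prod γ₂) (Prod.swap ⁻¹' largeFormsProd σ S (√n) z t) =
      (γ₂.prod γ₁) (largeFormsProd σ S (√n) z t) :=
    (Measure.measurePreserving_swap (μ := γ₁) (ν := γ₂)).measure_preimage
      (isOpen_largeFormsProd hσ.continuous S (√n) hzpos t).measurableSet.nullMeasurableSet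
  set G : Set Ω := {ω | ResolventBounds (featureMatrix σ (X ω) (W ω)) z
    (8 * C * c⁻¹ ^ 2 * (n : ℝ) ^ (6 * δ - 1 / 2))} with hG
  have hGc : μ Gᶜ ≤ ENNReal.ofReal (2 * K * (n : ℝ) ^ (-D)) := by
    have hset : Gᶜ = {ω | ((fun a => WithLp.toLp 2 (X ω a)),
        fun α => WithLp.toLp 2 (fun j => W ω j α)) ∈ sᶜ} := rfl
    rw [hset, hcompl]
    refine (measure_mono hsub).trans ((measure_union_le _ _).trans ?_)
    rw [hswap]
    refine (add_le_add t₁ t₂).trans (le_of_eq ?_)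
    rw [← ENNReal.ofReal_add (by positivity) (by positivity)]
    congr 1
    ring
  -- Subadditivity suffices here, so measurability of `G` in `Ω` is not required.
  have h1 : (1 : ℝ) ≤ μ.real G + μ.real Gᶜ := by
    have := measureReal_union_le (μ := μ) G Gᶜ
    rwa [Set.union_compl_self, probReal_univ] at this
  have h2 : μ.real Gᶜ ≤ 2 * K * (n : ℝ) ^ (-D) := by
    rw [Measure.real]
    exact ENNReal.toReal_le_of_le_ofReal (by positivity) hGc
  have h3 : 0 ≤ (n : ℝ) ^ (-D) := by positivity
  linarith
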